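/- Let $K$ be a field, $q\in K$ and $M\ge 1$. Let $V$ have basis $e_1,\dots,e_{M+1}$ with matrix units $E_{ij}e_k=\delta_{jk}e_i$. The stochastic $U_q(\widehat{\mathfrak{sl}}_{M+1})$ $R$-matrix is $$R(u,v)=\sum_{i}(u-qv)E_{ii}\otimes E_{ii}+\sum_{i>j}q(u-v)E_{ii}\otimes E_{jj}+\sum_{i<j}(u-v)E_{ii}\otimes E_{jj}+\sum_{i>j}(1-q)u\,E_{ij}\otimes E_{ji}+\sum_{i<j}(1-q)v\,E_{ij}\otimes E_{ji}.$$ At a crossing of a horizontal line (variable $u$, colour $a$ on the left edge, $c$ on the right edge) and a vertical line (variable $v$, colour $b$ on the bottom edge, $d$ on the top edge), the weight is the coefficient of $e_c\otimes e_d$ in $R(u,v)(e_a\otimes e_b)$. **Data.** Let $k_1,\dots,k_M$, $L^{\mathrm I}_j,L^{\mathrm{II}}_j$ ($1\le j\le M-1$) and $L_M$ be non-negative integers. Let $u^{(j)}_1,\dots,u^{(j)}_{k_j}$ ($1\le j\le M$) be elements of $K$ that are pairwise distinct for each fixed $j$, and let $v^{(j)}_{\mathrm I,1},\dots,v^{(j)}_{\mathrm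 I,L^{\mathrm I}_j}$, $v^{(j)}_{\mathrm{II},1},\dots,v^{(j)}_{\mathrm{II},L^{\mathrm{II}}_j}$ ($j<M$) and $v^{(M)}_1,\dots,v^{(M)}_{L_M}$ be elements of $K$. The quantum spaces with variables $\boldsymbol v_{\mathrm I}^{(1)},\dots,\boldsymbol v_{\mathrm I}^{(M-1)},\boldsymbol v^{(M)},\boldsymbol v_{\mathrm{II}}^{(M-1)},\dots,\boldsymbol v_{\mathrm{II}}^{(1)}$, in this order, are given the coordinates $1,2,\dots$; those with variables $\boldsymbol v_{\mathrm I}^{(j)},\boldsymbol v_{\mathrm{II}}^{(j)}$ (or $\boldsymbol v^{(M)}$ for $j=M$) belong to layer $j$. Each coordinate carries a colour, which in layer $j$ is one of $1,\dots,j+1$. Let $\widehat{\boldsymbol I}^{(j)}$ be the set of coordinates in layers $j,\dots,M$, and $\boldsymbol I^{(j)}=\{I^{(j)}_1<I^{(j)}_2<\cdots\}\subset\widehat{\boldsymbol I}^{(j)}$ the subset of coordinates with colour in $\{1,\dots,j\}$; assume $|\boldsymbol I^{(j)}|=k_j$ for $1\le j\le M$. Remove from $\widehat{\boldsymbol I}^{(j)}$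 all coordinates with colours $j+2,\dots,M+1$ and relabel the remaining ones, in order, by $1,2,\dots$; the image of $\boldsymbol I^{(j)}$ is $\widetilde{\boldsymbol I}^{(j)}=\{\widetilde I^{(j)}_1<\dots<\widetilde I^{(j)}_{k_j}\}$. **Partition function.** Layer $j$ is a rectangular grid. Its horizontal lines have variables $u^{(j)}_1,\dots,u^{(j)}_{k_j}$ from top to bottom. Its vertical lines have, from left to right, the variables $\boldsymbol v^{(j)}_{\mathrm I},\boldsymbol u^{(j+1)},\boldsymbol v^{(j)}_{\mathrm{II}}$ if $j<M$, and $\boldsymbol v^{(M)}$ if $j=M$. All bottom edges and all right edges of layer $j$ have colour $j+1$. The left edges of layer $1$ have colour $1$. For $j<M$ the vertical line with variable $u^{(j+1)}_i$ leaves layer $j$ at the top and becomes the horizontal line of layer $j+1$ with the same variable, entering from the left. The top edges of the quantum spaces carry the given colours. The partition function $\psi$ is the sum over all colourings of the remaining edges by $1,\dots,M+1$ of the product of the weights of all crossings of all layers. **Weight function.** For $1\le p\le M-1$ and $\sigma\in S_{k_{p+1}}$ let $m^{(p)}_{i}(\sigma)$ be the $i$-th entry of the sequence $v^{(p)}_{\mathrm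 I,1},\dots,v^{(p)}_{\mathrm I,L^{\mathrm I}_p},u^{(p+1)}_{\sigma(1)},\dots,u^{(p+1)}_{\sigma(k_{p+1})},v^{(p)}_{\mathrm{II},1},\dots,v^{(p)}_{\mathrm{II},L^{\mathrm{II}}_p}$, and put $n_p=L^{\mathrm I}_p+k_{p+1}+L^{\mathrm{II}}_p$. With $I'_a=I^{(M)}_a-L_1^{\mathrm I}-\cdots-L_{M-1}^{\mathrm I}$, put $$\begin{aligned}W=\sum_{\sigma_1\in S_{k_1}}\cdots\sum_{\sigma_M\in S_{k_M}}&\prod_{p=1}^{M-1}\Bigg\{\prod_{a=1}^{k_p}\Bigg(\prod_{i=1}^{\widetilde I^{(p)}_a-1}\big(u^{(p)}_{\sigma_p(a)}-m^{(p)}_i(\sigma_{p+1})\big)\,(1-q)u^{(p)}_{\sigma_p(a)}\prod_{i=\widetilde I^{(p)}_a+1}^{n_p}\big(u^{(p)}_{\sigma_p(a)}-q\,m^{(p)}_i(\sigma_{p+1})\big)\Bigg)\prod_{1\le a<b\le k_p}\frac{qu^{(p)}_{\sigma_p(a)}-u^{(p)}_{\sigma_p(b)}}{u^{(p)}_{\sigma_p(a)}-u^{(p)}_{\sigma_p(b)}}\Bigg\}\\&\times\prod_{a=1}^{k_M}\Bigg(\prod_{i=1}^{I'_a-1}\big(u^{(M)}_{\sigma_M(a)}-v^{(M)}_i\big)\,(1-q)u^{(M)}_{\sigma_M(a)}\prod_{i=I'_a+1}^{L_M}\big(u^{(M)}_{\sigma_M(a)}-q\,v^{(M)}_i\big)\Bigg)\prod_{1\le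 a<b\le k_M}\frac{qu^{(M)}_{\sigma_M(a)}-u^{(M)}_{\sigma_M(b)}}{u^{(M)}_{\sigma_M(a)}-u^{(M)}_{\sigma_M(b)}}.\end{aligned}$$ **Theorem.** $\psi=W$. -/

import Mathlib

open scoped Kronecker

namespace NestedLattice

/-! Indices are zero-based where they come from `Fin`: with `M = m + 1`, the index
`p : Fin (m + 1)` stands for layer `p + 1`, and the colour `c : Fin (m + 2)` stands for the
colour `c + 1` in `{1, …, M + 1}`. For `p : Fin m`, the layer `p.castSucc` is a layer below the
top one and `p.succ` is the layer above it. Coordinates of quantum spaces are the natural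
numbers `1, 2, …` as usual. -/

/-- The trigonometric stochastic `R`-matrix on `V ⊗ V`, where `V` has the basis `e_i`
(`i : Fin N`); `Matrix.single i j 1` is the matrix unit `E_ij`. -/
def trigR {K : Type*} [CommRing K] (N : ℕ) (q u v : K) :
    Matrix (Fin N × Fin N) (Fin N × Fin N) K :=
  (∑ i : Fin N, (u - q * v) • (Matrix.single i i (1 : K) ⊗ₖ Matrix.single i i (1 : K)))
  + (∑ i : Fin N, ∑ j : Fin N with j < i,
      (q * (u - v)) • (Matrix.single i i (1 : K) ⊗ₖ Matrix.single j j (1 : K)))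
  + (∑ i : Fin N, ∑ j : Fin N with i < j,
      (u - v) • (Matrix.single i i (1 : K) ⊗ₖ Matrix.single j j (1 : K)))
  + (∑ i : Fin N, ∑ j : Fin N with j < i,
      ((1 - q) * u) • (Matrix.single i j (1 : K) ⊗ₖ Matrix.single j i (1 : K)))
  + (∑ i : Fin N, ∑ j : Fin N with i < j,
      ((1 - q) * v) • (Matrix.single i j (1 : K) ⊗ₖ Matrix.single j i (1 : K)))

/-- The weight of a vertex at which a horizontal line (first tensor factor) enters from the left
with colour `a` and leaves to the right with colour `c`, and a vertical line (second tensor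
factor) enters from the bottom with colour `b` and leaves at the top with colour `d`:
the coefficient of `e_c ⊗ e_d` in `R(u, v) (e_a ⊗ e_b)`. -/
def vertexWeight {K : Type*} [CommRing K] {N : ℕ} (q u v : K) (a b c d : Fin N) : K :=
  trigR N q u v (c, d) (a, b)

/-- The partition function of a rectangular grid with horizontal lines `0, …, k - 1` (from top to
bottom, spectral variables `x`) and vertical lines `0, …, n - 1` (from left to right, spectral
variables `y`) and prescribed boundary colours: the sum over all colourings of the edges that
agree with the boundary colours of the product of the vertex weights. Here `h i j` is the colour
of the `j`-th edge (from the left) on the `i`-th horizontal line, and `w i j` is the colour of the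
`i`-th edge (from the top) on the `j`-th vertical line. -/
def gridZ {K : Type*} [CommRing K] {N k n : ℕ} (q : K) (x : Fin k → K) (y : Fin n → K)
    (left right : Fin k → Fin N) (bottom top : Fin n → Fin N) : K :=
  ∑ h : Fin k → Fin (n + 1) → Fin N, ∑ w : Fin (k + 1) → Fin n → Fin N,
    if (∀ i, h i 0 = left i) ∧ (∀ i, h i (Fin.last n) = right i) ∧
        (∀ j, w 0 j = top j) ∧ (∀ j, w (Fin.last k) j = bottom j) then
      ∏ i : Fin k, ∏ j : Fin n,
        vertexWeight q (x i) (y j) (h i j.castSucc) (w i.succ j) (h i j.succ) (w i.castSucc j)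
    else 0

/-- The sizes of the nested lattice with `M = m + 1` layers: the number `k p` of auxiliary spaces
of each layer, the numbers `LI p`, `LII p` of left and right quantum spaces of each layer below
the top one, and the number `LM` of quantum spaces of the top layer. -/
structure Shape (m : ℕ) where
  k : Fin (m + 1) → ℕ
  LI : Fin m → ℕ
  LII : Fin m → ℕ
  LM : ℕ

namespace Shape

variable {m : ℕ} (D : Shape m)

/-- The coordinate of the `i`-th left quantum space in a layer below the top one. -/
def coordI (p : Fin m) (i : Fin (D.LI p)) : ℕ :=
  (∑ r : Fin m with r < p, D.LI r) + i + 1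

/-- The coordinate of the `i`-th quantum space in the top layer. -/
def coordTop (i : Fin D.LM) : ℕ :=
  (∑ r : Fin m, D.LI r) + i + 1

/-- The coordinate of the `i`-th right quantum space in a layer below the top one. -/
def coordII (p : Fin m) (i : Fin (D.LII p)) : ℕ :=
  (∑ r : Fin m, D.LI r) + D.LM + (∑ r : Fin m with p < r, D.LII r) + i + 1

/-- The set of all coordinates from layer `p` to the top layer. -/
def hatI (p : Fin (m + 1)) : Finset ℕ :=
  Finset.Icc ((∑ r : Fin m with r.castSucc < p, D.LI r) + 1)
    ((∑ r : Fin m, D.LI r) + D.LM + ∑ r : Fin m with p ≤ r.castSucc, D.LII r)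

/-- The coordinates from layer `p` to the top layer that have one of the colours `1, …, j`,
where `j` is the number of the layer (that is, zero-based colour at most `p`). -/
def setI (c : ℕ → Fin (m + 2)) (p : Fin (m + 1)) : Finset ℕ :=
  (D.hatI p).filter fun l => c l ≤ p.castSucc

/-- The induced set: in `hatI p` the coordinates with a zero-based colour larger than `p + 1` are
removed, the remaining ones are relabelled by `1, 2, …` in their order, and `tildeI` is the image
of `setI` under this relabelling. -/
def tildeI (c : ℕ → Fin (m + 2)) (p : Fin (m + 1)) : Finset ℕ :=
  (D.setI c p).image fun j => ((D.hatI p).filter fun l => c l ≤ p.succ ∧ l ≤ j).card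

/-- A colouring of the coordinates is admissible if in each layer only the colours that occur in
that layer are used (colours `1, …, j + 1` in layer number `j`), and if the number of auxiliary
spaces in each layer is the size of the corresponding set `setI`. -/
structure Admissible (c : ℕ → Fin (m + 2)) : Prop where
  left_le : ∀ (p : Fin m) (i : Fin (D.LI p)), c (D.coordI p i) ≤ p.castSucc.succ
  right_le : ∀ (p : Fin m) (i : Fin (D.LII p)), c (D.coordII p i) ≤ p.castSucc.succ
  card_eq : ∀ p : Fin (m + 1), (D.setI c p).card = D.k p

end Shape

/-- The spectral variables: `u p` for the auxiliary spaces of each layer, `vI p` and `vII p` for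
the left and right quantum spaces of each layer below the top one, `vM` for the quantum spaces of
the top layer. -/
structure Spectral {m : ℕ} (D : Shape m) (K : Type*) where
  u : (p : Fin (m + 1)) → Fin (D.k p) → K
  vI : (p : Fin m) → Fin (D.LI p) → K
  vII : (p : Fin m) → Fin (D.LII p) → K
  vM : Fin D.LM → K

/-- The sequence consisting of a left, a middle and a right part. -/
def join {α : Type*} {a b c : ℕ} (l : Fin a → α) (x : Fin b → α) (r : Fin c → α) :
    Fin (a + b + c) → α :=
  Fin.append (Fin.append l x) r

/-- The colours entering the auxiliary spaces of each layer from the left: the colour `1` in the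
bottom layer; in the other layers the colours `s` leaving the layer below on the vertical lines
that turn into the auxiliary spaces. -/
def leftColours {m : ℕ} (D : Shape m) (s : (p : Fin m) → Fin (D.k p.succ) → Fin (m + 2)) :
    (p : Fin (m + 1)) → Fin (D.k p) → Fin (m + 2) :=
  Fin.cases (fun _ => 0) s

/-- The trigonometric partition function. In layer number `j` all lines entering from the bottom
and all lines leaving to the right have colour `j + 1`; the quantum spaces leave at the top with
the colours given by `c`. In each layer below the top one the vertical lines are, from left to
right, the left quantum spaces, the lines which turn (without crossing) into the horizontal lines
of the next layer, and the right quantum spaces. The sum is over the colours `s` of the edges that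
connect consecutive layers. -/
def psi {m : ℕ} {K : Type*} [CommRing K] (q : K) (D : Shape m) (X : Spectral D K)
    (c : ℕ → Fin (m + 2)) : K :=
  ∑ s : (p : Fin m) → Fin (D.k p.succ) → Fin (m + 2),
    (∏ p : Fin m,
      gridZ q (X.u p.castSucc) (join (X.vI p) (X.u p.succ) (X.vII p))
        (leftColours D s p.castSucc) (fun _ => p.castSucc.succ) (fun _ => p.castSucc.succ)
        (join (fun i => c (D.coordI p i)) (s p) (fun i => c (D.coordII p i)))) *
    gridZ q (X.u (Fin.last m)) X.vM
      (leftColours D s (Fin.last m)) (fun _ => Fin.last (m + 1)) (fun _ => Fin.last (m + 1))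
      (fun i => c (D.coordTop i))

/-- One layer of a summand of the weight function, with auxiliary variables `x` (already
permuted), quantum variables `y` and (one-based) positions `P`. -/
def layerFactor {K : Type*} [Field K] {k n : ℕ} (q : K) (x : Fin k → K) (y : Fin n → K)
    (P : Fin k → ℕ) : K :=
  (∏ a : Fin k,
    ((∏ i : Fin n with i.val + 1 < P a, (x a - y i)) *
      ((1 - q) * x a) *
      (∏ i : Fin n with P a < i.val + 1, (x a - q * y i)))) *
  ∏ a : Fin k, ∏ b : Fin k with a < b, (q * x a - x b) / (x a - x b)

/-- The extended trigonometric weight function; `Nat.nth (· ∈ S) a` is the `a`-th smallest element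
(counted from zero) of the set `S`. -/
noncomputable def weightW {m : ℕ} {K : Type*} [Field K] (q : K) (D : Shape m) (X : Spectral D K)
    (c : ℕ → Fin (m + 2)) : K :=
  ∑ σ : (p : Fin (m + 1)) → Equiv.Perm (Fin (D.k p)),
    (∏ p : Fin m,
      layerFactor q (fun a => X.u p.castSucc (σ p.castSucc a))
        (join (X.vI p) (fun i => X.u p.succ (σ p.succ i)) (X.vII p))
        (fun a => Nat.nth (· ∈ D.tildeI c p.castSucc) a)) *
    layerFactor q (fun a => X.u (Fin.last m) (σ (Fin.last m) a)) X.vM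
      (fun a => Nat.nth (· ∈ D.setI c (Fin.last m)) a - ∑ r : Fin m, D.LI r)

end NestedLattice

/-! A rectangular layer is built column by column: `step` turns a function `f` of the (colour,
variable) pairs on the left edges of the rows into the corresponding function of the right edges.
The central property is `Exchange`: interchanging the variables of two neighbouring lines amounts to
crossing these lines. It passes through a column (`Exchange.step`) and also holds in the columns
themselves (`exchange_columns`), both by Yang–Baxter. Since the vertical lines of one layer become
the rows of the next, every `lowerZ`, the partition function of the layers below a given one,
satisfies `Exchange`; for the bottom layer it is just the indicator of colour `1`.

For a single layer over an exchangeable `f`, with `N` on all right and bottom edges,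
`columns_eq_sum` gives a sum over permutations. The rightmost column is peeled off. If its top
colour is `N`, all its vertices are frozen. If its top colour is `b < N`, exactly one row of right
colour `N` acquires colour `b` there; `Exchange` moves this row below the other rows coloured `N`,
with partial-fraction coefficients. The variable of the moved row becomes the value of the
permutation at the last position.

Finally, the values of `lowerZ` at the colours of `setI c p`, taken in increasing order of
coordinates, with variables permuted by `σ`, satisfy a linear recursion in `p` with kernel
`layerFactor`. Unfolding it with `sum_pi_eq_sum_last` produces the nested sum of the weight
function. -/

namespace NestedLattice

/-! ### Column operators, the exchange relation and Yang–Baxter. -/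

section Weights

variable {K C : Type*} [CommRing K] [LinearOrder C]

/-- The weight of a vertex at which the lines leaving with the colours `c`, `d` do not exchange
colours. -/
def passWeight (q u v : K) (c d : C) : K :=
  if c = d then u - q * v else if d < c then q * (u - v) else u - v

/-- The weight of a vertex at which the lines leaving with the distinct colours `c`, `d` exchange
colours. -/
def swapWeight (q u v : K) (c d : C) : K :=
  if c = d then 0 else if d < c then (1 - q) * u else (1 - q) * v

theorem vertexWeight_eq {n : ℕ} (q u v : K) (a b c d : Fin n) :
    vertexWeight q u v a b c d =
      (if a = c ∧ b = d then passWeight q u v c d else 0) +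
        (if a = d ∧ b = c then swapWeight q u v c d else 0) := by
  have key : ∀ (s : Fin n → Fin n → Prop) [∀ i j, Decidable (s i j)] (w : K) (i₁ i₂ j₁ j₂ : Fin n),
      (∑ i : Fin n, ∑ j : Fin n with s i j,
        w * ((if i = i₁ ∧ i = i₂ then (1 : K) else 0) *
          (if j = j₁ ∧ j = j₂ then 1 else 0))) =
      if i₁ = i₂ ∧ j₁ = j₂ ∧ s i₁ j₁ then w else 0 := by
    intro s _ w i₁ i₂ j₁ j₂
    rw [Finset.sum_eq_single i₁, Finset.sum_filter, Finset.sum_eq_single j₁]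
    · by_cases h₁ : i₁ = i₂ <;> by_cases h₂ : j₁ = j₂ <;> simp [h₁, h₂]
    · intro j _ hj; simp [hj]
    · simp
    · intro i _ hi; simp [hi]
    · simp
  have key' : ∀ (s : Fin n → Fin n → Prop) [∀ i j, Decidable (s i j)] (w : K) (i₁ i₂ j₁ j₂ : Fin n),
      (∑ i : Fin n, ∑ j : Fin n with s i j,
        w * ((if i = i₁ ∧ j = j₁ then (1 : K) else 0) *
          (if j = j₂ ∧ i = i₂ then 1 else 0))) =
      if i₁ = i₂ ∧ j₁ = j₂ ∧ s i₁ j₁ then w else 0 := by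
    intro s _ w i₁ i₂ j₁ j₂
    rw [← key s w i₁ i₂ j₁ j₂]
    refine Finset.sum_congr rfl fun i _ => Finset.sum_congr rfl fun j _ => ?_
    congr 1
    simp only [mul_ite, mul_one, mul_zero, ← ite_and]
    refine if_congr ?_ rfl rfl
    tauto
  have key₀ : (∑ i : Fin n, (u - q * v) * ((if i = c ∧ i = a then (1 : K) else 0) *
      (if i = d ∧ i = b then 1 else 0))) =
      if c = a ∧ d = b ∧ c = d then u - q * v else 0 := by
    rw [Finset.sum_eq_single c]
    · by_cases h₁ : c = a <;> by_cases h₂ : c = d <;> by_cases h₃ : d = b <;> simp_all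
    · intro i _ hi; simp [hi]
    · simp
  unfold vertexWeight trigR
  simp only [Matrix.add_apply, Matrix.sum_apply, Matrix.smul_apply, Matrix.kroneckerMap_apply,
    Matrix.single_apply, smul_eq_mul]
  rw [key₀, key, key, key', key']
  clear key key' key₀
  unfold passWeight swapWeight
  have e₁ : (c = a ∧ d = b ∧ c = d ↔ (a = c ∧ b = d) ∧ c = d) := by tauto
  have e₂ : (c = a ∧ d = b ∧ d < c ↔ (a = c ∧ b = d) ∧ d < c) := by tauto
  have e₃ : (c = a ∧ d = b ∧ c < d ↔ (a = c ∧ b = d) ∧ c < d) := by tauto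
  have e₄ : (c = b ∧ a = d ∧ a < c ↔ (a = d ∧ b = c) ∧ d < c) := by
    constructor
    · rintro ⟨rfl, rfl, h⟩; exact ⟨⟨rfl, rfl⟩, h⟩
    · rintro ⟨⟨rfl, rfl⟩, h⟩; exact ⟨rfl, rfl, h⟩
  have e₅ : (c = b ∧ a = d ∧ c < a ↔ (a = d ∧ b = c) ∧ c < d) := by
    constructor
    · rintro ⟨rfl, rfl, h⟩; exact ⟨⟨rfl, rfl⟩, h⟩
    · rintro ⟨⟨rfl, rfl⟩, h⟩; exact ⟨rfl, rfl, h⟩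
  simp only [e₁, e₂, e₃, e₄, e₅]
  rcases lt_trichotomy c d with h | h | h
  · simp only [h, h.ne, h.not_gt, and_true, and_false, if_false, add_zero, zero_add]
  · simp only [h, lt_irrefl, and_true, and_false, if_true, if_false, add_zero, ite_self]
  · simp only [h, h.ne', h.not_gt, and_true, and_false, if_true, if_false, add_zero, zero_add]

/-- The action of a column with variable `y`, bottom colour `N` and top colour `t` on a function
`f` of the colours and the variables of the horizontal lines. -/
def step (q : K) (N : C) (y : K) : C → (List (C × K) → K) → List (C × K) → K
  | t, f, [] => if t = N then f [] else 0
  | t, f, (c, x) :: l =>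
      passWeight q x y c t * step q N y t (fun l' => f ((c, x) :: l')) l +
        swapWeight q x y c t * step q N y c (fun l' => f ((t, x) :: l')) l

theorem step_nil (q : K) (N : C) (y : K) (t : C) (f : List (C × K) → K) :
    step q N y t f [] = if t = N then f [] else 0 := by
  rw [step]

theorem step_cons (q : K) (N : C) (y : K) (t : C) (f : List (C × K) → K) (c : C) (x : K)
    (l : List (C × K)) :
    step q N y t f ((c, x) :: l) =
      passWeight q x y c t * step q N y t (fun l' => f ((c, x) :: l')) l +
        swapWeight q x y c t * step q N y c (fun l' => f ((t, x) :: l')) l := by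
  rw [step]

theorem step_linear (q : K) (N : C) (y : K) (t : C) (α β : K) (f g : List (C × K) → K)
    (l : List (C × K)) :
    step q N y t (fun l' => α * f l' + β * g l') l =
      α * step q N y t f l + β * step q N y t g l := by
  induction l generalizing t f g with
  | nil => simp only [step_nil]; split_ifs <;> ring
  | cons a l ih =>
    obtain ⟨c, x⟩ := a
    simp only [step_cons, ih]
    ring

theorem step_mul_left (q : K) (N : C) (y : K) (t : C) (α : K) (f : List (C × K) → K)
    (l : List (C × K)) :
    step q N y t (fun l' => α * f l') l = α * step q N y t f l := by
  simpa using step_linear q N y t α 0 f f l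

/-- The exchange relation: interchanging the variables of neighbouring lines is the same as
crossing these lines. -/
def Exchange (q : K) (f : List (C × K) → K) : Prop :=
  ∀ (p l : List (C × K)) (a b : C) (u v : K),
    (u - q * v) * f (p ++ (a, v) :: (b, u) :: l) =
      passWeight q u v b a * f (p ++ (b, u) :: (a, v) :: l) +
        swapWeight q u v b a * f (p ++ (a, u) :: (b, v) :: l)

theorem Exchange.cons {q : K} {f : List (C × K) → K} (hf : Exchange q f) (z : C × K) :
    Exchange q fun l => f (z :: l) :=
  fun p l => hf (z :: p) l

/-- Yang–Baxter equation for two rows `u`, `v` and one column `y`; `g` is an arbitrary function of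
the colours on row `u`, row `v` and the column. The weights see only the relative order of colours,
so each case is a polynomial identity. -/
theorem yangBaxter_rows (q y u v : K) (a b t : C) (g : C → C → C → K) :
    passWeight q v y a t *
        (passWeight q u y b t * (passWeight q u v b a * g b a t + swapWeight q u v b a * g a b t) +
         swapWeight q u y b t *
          (passWeight q u v t a * g t a b + swapWeight q u v t a * g a t b)) +
      swapWeight q v y a t *
        (passWeight q u y b a * (passWeight q u v b t * g b t a + swapWeight q u v b t * g t b a) +
         swapWeight q u y b a *
          (passWeight q u v a t * g a t b + swapWeight q u v a t * g t a b)) =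
    passWeight q u v b a *
        (passWeight q u y b t * (passWeight q v y a t * g b a t + swapWeight q v y a t * g b t a) +
         swapWeight q u y b t *
          (passWeight q v y a b * g t a b + swapWeight q v y a b * g t b a)) +
      swapWeight q u v b a *
        (passWeight q u y a t * (passWeight q v y b t * g a b t + swapWeight q v y b t * g a t b) +
         swapWeight q u y a t *
          (passWeight q v y b a * g t b a + swapWeight q v y b a * g t a b)) := by
  unfold passWeight swapWeight
  rcases lt_trichotomy a b with h₁ | h₁ | h₁ <;> rcases lt_trichotomy b t with h₂ | h₂ | h₂ <;>
    rcases lt_trichotomy a t with h₃ | h₃ | h₃ <;>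
    first
    | (exfalso; order)
    | (simp only [h₁, h₂, h₃, h₁.ne, h₂.ne, h₃.ne, h₁.ne', h₂.ne', h₃.ne', h₁.not_gt, h₂.not_gt,
        h₃.not_gt, if_true, if_false]; ring)
    | (subst_vars
       simp only [*, ne_of_lt, ne_of_gt, not_lt_of_gt, lt_irrefl, if_true, if_false]; ring)

/-- Rows above the pair only change the colour carried down the column, which is why `t` and `f`
vary in the induction. At the pair itself the crossing is pulled through the column by Yang–Baxter.
-/
theorem Exchange.step {q : K} {f : List (C × K) → K} (hf : Exchange q f) (N : C) (y : K) (t : C) :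
    Exchange q (step q N y t f) := by
  intro p
  induction p generalizing f t with
  | nil =>
    intro l a b u v
    have h' : ∀ t₀ c d, (u - q * v) *
        NestedLattice.step q N y t₀ (fun l' => f ((d, v) :: (c, u) :: l')) l =
          passWeight q u v c d *
            NestedLattice.step q N y t₀ (fun l' => f ((c, u) :: (d, v) :: l')) l +
          swapWeight q u v c d *
            NestedLattice.step q N y t₀ (fun l' => f ((d, u) :: (c, v) :: l')) l := by
      intro t₀ c d
      rw [← step_linear, ← step_mul_left]
      congr 1
      funext l'
      exact hf [] l' d c u v
    simp only [List.nil_append, step_cons]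
    have key := yangBaxter_rows q y u v a b t
      (fun c d e => NestedLattice.step q N y e (fun l' => f ((c, u) :: (d, v) :: l')) l)
    simp only [← h'] at key
    linear_combination key
  | cons z p ih =>
    intro l a b u v
    obtain ⟨c, x⟩ := z
    simp only [List.cons_append, step_cons]
    have h₁ := ih (hf.cons (c, x)) t l a b u v
    have h₂ := ih (hf.cons (t, x)) c l a b u v
    linear_combination passWeight q x y c t * h₁ + swapWeight q x y c t * h₂

theorem yangBaxter_columns (q x u v : K) (a b r : C) (g : C → C → C → K) :
    passWeight q x u r b *
        (passWeight q x v r a * (passWeight q u v b a * g r b a + swapWeight q u v b a * g r a b) +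
         swapWeight q x v r a *
          (passWeight q u v b r * g a b r + swapWeight q u v b r * g a r b)) +
      swapWeight q x u r b *
        (passWeight q x v b a * (passWeight q u v r a * g b r a + swapWeight q u v r a * g b a r) +
         swapWeight q x v b a *
          (passWeight q u v r b * g a r b + swapWeight q u v r b * g a b r)) =
    passWeight q u v b a *
        (passWeight q x v r a * (passWeight q x u r b * g r b a + swapWeight q x u r b * g b r a) +
         swapWeight q x v r a *
          (passWeight q x u a b * g a b r + swapWeight q x u a b * g b a r)) +
      swapWeight q u v b a *
        (passWeight q x v r b * (passWeight q x u r a * g r a b + swapWeight q x u r a * g a r b) +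
         swapWeight q x v r b *
          (passWeight q x u b a * g b a r + swapWeight q x u b a * g a b r)) := by
  unfold passWeight swapWeight
  rcases lt_trichotomy a b with h₁ | h₁ | h₁ <;> rcases lt_trichotomy b r with h₂ | h₂ | h₂ <;>
    rcases lt_trichotomy a r with h₃ | h₃ | h₃ <;>
    first
    | (exfalso; order)
    | (simp only [h₁, h₂, h₃, h₁.ne, h₂.ne, h₃.ne, h₁.ne', h₂.ne', h₃.ne', h₁.not_gt, h₂.not_gt,
        h₃.not_gt, if_true, if_false]; ring)
    | (subst_vars
       simp only [*, ne_of_lt, ne_of_gt, not_lt_of_gt, lt_irrefl, if_true, if_false]; ring)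

/-- The crossing of two columns is pulled down row by row. At the bottom both lines have colour `N`,
so the crossing contributes only the scalar `u - q * v`. -/
theorem step_step_exchange (q : K) (N : C) (a b : C) (u v : K) (f : List (C × K) → K)
    (l : List (C × K)) :
    (u - q * v) * step q N u b (step q N v a f) l =
      passWeight q u v b a * step q N v a (step q N u b f) l +
        swapWeight q u v b a * step q N v b (step q N u a f) l := by
  induction l generalizing f a b with
  | nil =>
    simp only [step_nil, passWeight, swapWeight]
    by_cases ha : a = N <;> by_cases hb : b = N
    · simp [ha, hb]
    · simp [ha, hb]
    · simp [ha, hb]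
    · simp [ha, hb]
  | cons z l ih =>
    obtain ⟨r, x⟩ := z
    have h : ∀ u v a b c, step q N u b (fun l' => step q N v a f ((c, x) :: l')) l =
        passWeight q x v c a * step q N u b (step q N v a fun l' => f ((c, x) :: l')) l +
        swapWeight q x v c a * step q N u b (step q N v c fun l' => f ((a, x) :: l')) l := by
      intro u v a b c
      rw [← step_linear]
      simp only [step_cons]
    rw [step_cons, step_cons, step_cons]
    simp only [h]
    have key := yangBaxter_columns q x u v a b r
      (fun c d e => step q N v e (step q N u d fun l' => f ((c, x) :: l')) l)
    simp only [← ih] at key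
    linear_combination key

/-- The function obtained from `f` by the columns `cols` (top colours and variables). -/
def columns (q : K) (N : C) (f : List (C × K) → K) (cols : List (C × K)) : List (C × K) → K :=
  cols.foldl (fun g z => step q N z.2 z.1 g) f

theorem Exchange.columns {q : K} {f : List (C × K) → K} (hf : Exchange q f) (N : C)
    (cols : List (C × K)) : Exchange q (columns q N f cols) := by
  induction cols generalizing f with
  | nil => exact hf
  | cons z cols ih => exact ih (hf.step N z.2 z.1)

theorem columns_linear (q : K) (N : C) (α β : K) (f g : List (C × K) → K)
    (cols l : List (C × K)) :
    columns q N (fun l' => α * f l' + β * g l') cols l =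
      α * columns q N f cols l + β * columns q N g cols l := by
  induction cols generalizing f g with
  | nil => rfl
  | cons z cols ih =>
    have h : NestedLattice.step q N z.2 z.1 (fun l' => α * f l' + β * g l') =
        fun l' => α * step q N z.2 z.1 f l' + β * step q N z.2 z.1 g l' :=
      funext fun l' => step_linear ..
    simp only [columns, List.foldl_cons, h]
    exact ih ..

theorem columns_append (q : K) (N : C) (f : List (C × K) → K) (cols cols' : List (C × K)) :
    columns q N f (cols ++ cols') = columns q N (columns q N f cols) cols' :=
  List.foldl_append ..

/-- Here the argument is a block of vertical lines, not the rows: these are the lines that turn into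
the rows of the next layer. Nothing is required of `f`. -/
theorem exchange_columns (q : K) (N : C) (f : List (C × K) → K) (pre post l : List (C × K)) :
    Exchange q fun cols => columns q N f (pre ++ cols ++ post) l := by
  intro p s a b u v
  simp only [List.append_assoc, List.cons_append, columns_append _ _ _ pre,
    columns_append _ _ _ p]
  generalize NestedLattice.columns q N (NestedLattice.columns q N f pre) p = g
  have h := columns_linear q N (passWeight q u v b a) (swapWeight q u v b a)
    (step q N v a (step q N u b g)) (step q N v b (step q N u a g)) (s ++ post) l
  have h' := columns_linear q N (u - q * v) 0 (step q N u b (step q N v a g)) g (s ++ post) l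
  simp only [← step_step_exchange] at h
  simp only [zero_mul, add_zero] at h'
  exact h'.symm.trans h

end Weights

/-! ### One column over rows whose right colour is `N`. -/

section Columns

variable {K C : Type*} [Field K] [LinearOrder C]

/-- Once the vertical line has a colour below `N`, swapping with rows below `N` never restores `N`.
Hence it must carry `N` from top to bottom and only pass. -/
theorem step_of_lt (q : K) {N : C} (y : K) (t : C) (f : List (C × K) → K) (as : List (C × K))
    (has : ∀ a ∈ as, a.1 < N) :
    step q N y t f as = if t = N then (as.map fun a => a.2 - y).prod * f as else 0 := by
  induction as generalizing t f with
  | nil => simp [step_nil]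
  | cons a as ih =>
    obtain ⟨c, x⟩ := a
    have hc : c < N := has (c, x) (by simp)
    have ih' := fun t f => ih t f fun a ha => has a (by simp [ha])
    rw [step_cons, ih', ih', if_neg hc.ne]
    split_ifs with ht
    · subst ht
      simp only [passWeight, hc.ne, hc.not_gt, if_false, List.map_cons, List.prod_cons]
      ring
    · simp

theorem step_self (q : K) {N : C} (y : K) (f : List (C × K) → K) (us : List K)
    (as : List (C × K)) (has : ∀ a ∈ as, a.1 < N) :
    step q N y N f (us.map (N, ·) ++ as) =
      (us.map fun u => u - q * y).prod * ((as.map fun a => a.2 - y).prod *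
        f (us.map (N, ·) ++ as)) := by
  induction us generalizing f with
  | nil => simp [step_of_lt q y N f as has]
  | cons u us ih =>
    simp only [List.map_cons, List.cons_append, step_cons, passWeight, swapWeight, if_true, ih,
      List.prod_cons]
    ring

variable [DecidableEq K]

/-- The row of colour `b` is pushed past the rows of colour `N` one at a time. Each move either
keeps its variable or trades it with the neighbour's, so every variable `v` can end up with colour
`b`; the coefficients combine by partial fractions. -/
theorem Exchange.move {q : K} {f : List (C × K) → K} (hf : Exchange q f) {N b : C} (hb : b < N)
    (T : List K) (as : List (C × K)) (G : K → K)
    (hG : ∀ ls v, (v :: ls).Perm T → f (ls.map (N, ·) ++ (b, v) :: as) = G v)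
    (us ws : List K) (u : K) (hT : (u :: us ++ ws).Perm T) (hu : (u :: us).Nodup) :
    f (ws.map (N, ·) ++ (b, u) :: (us.map (N, ·) ++ as)) =
      (∏ l ∈ us.toFinset, (q * l - u) / (l - u)) * G u +
        ∑ v ∈ us.toFinset, -((1 - q) * v / (u - v)) *
          (∏ l ∈ us.toFinset.erase v, (q * l - v) / (l - v)) * G v := by
  induction us generalizing ws u with
  | nil => simpa using hG ws u hT
  | cons u₁ us ih =>
    have hne : u ≠ u₁ := by rintro rfl; simp at hu
    have hu_us : u ∉ us := by intro h; simp [h] at hu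
    have hu₁_us : u₁ ∉ us := by intro h; simp [h] at hu
    have hus : us.Nodup := by simp at hu; exact hu.2.2
    have h₁ := ih (ws ++ [u₁]) u (by
      refine List.Perm.trans ?_ hT
      simp only [List.cons_append, List.perm_cons]
      rw [← List.append_assoc]
      exact List.perm_append_singleton u₁ _ ) (by simp [hu_us, hus])
    have h₂ := ih (ws ++ [u]) u₁ (by
      refine List.Perm.trans ?_ hT
      simp only [List.cons_append]
      refine List.Perm.trans ?_ (List.Perm.swap ..)
      rw [List.perm_cons, ← List.append_assoc]
      exact List.perm_append_singleton u _ ) (by simp [hu₁_us, hus])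
    have hex := hf (ws.map (N, ·)) (us.map (N, ·) ++ as) N b u u₁
    simp only [passWeight, swapWeight, hb.ne, hb.not_gt, if_false] at hex
    simp only [List.map_append, List.map_cons, List.map_nil, List.append_assoc, List.cons_append,
      List.nil_append] at h₁ h₂ ⊢
    rw [h₁, h₂] at hex
    have hd : u - u₁ ≠ 0 := sub_ne_zero.2 hne
    have hd' : u₁ - u ≠ 0 := sub_ne_zero.2 hne.symm
    have hm : u₁ ∉ us.toFinset := by simpa using hu₁_us
    rw [List.toFinset_cons, Finset.prod_insert hm, Finset.sum_insert hm, Finset.erase_insert hm]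
    refine mul_left_cancel₀ hd (Eq.trans (eq_sub_of_add_eq hex.symm) ?_)
    -- The identity behind this is `(u - q u₁)(u₁ - v) - (1 - q) u₁ (u - v) = (u - u₁)(q u₁ - v)`.
    have hs : ∀ v ∈ us.toFinset, -((1 - q) * v / (u - v)) *
          (∏ l ∈ (insert u₁ us.toFinset).erase v, (q * l - v) / (l - v)) * G v =
        (u - q * u₁) / (u - u₁) * (-((1 - q) * v / (u - v)) *
          (∏ l ∈ us.toFinset.erase v, (q * l - v) / (l - v)) * G v) -
        (1 - q) * u₁ / (u - u₁) * (-((1 - q) * v / (u₁ - v)) *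
          (∏ l ∈ us.toFinset.erase v, (q * l - v) / (l - v)) * G v) := by
      intro v hv
      have hv' : v ∈ us := by simpa using hv
      have h1 : u₁ ≠ v := fun h => hu₁_us (h ▸ hv')
      have h2 : u ≠ v := fun h => hu_us (h ▸ hv')
      have h1' := sub_ne_zero.2 h1
      have h2' := sub_ne_zero.2 h2
      rw [Finset.erase_insert_of_ne h1, Finset.prod_insert (by simp [hu₁_us])]
      field_simp
      ring
    rw [Finset.sum_congr rfl hs, Finset.sum_sub_distrib, ← Finset.mul_sum, ← Finset.mul_sum]
    generalize (∑ v ∈ us.toFinset, -((1 - q) * v / (u - v)) *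
          (∏ l ∈ us.toFinset.erase v, (q * l - v) / (l - v)) * G v) = S₁
    generalize (∑ v ∈ us.toFinset, -((1 - q) * v / (u₁ - v)) *
          (∏ l ∈ us.toFinset.erase v, (q * l - v) / (l - v)) * G v) = S₂
    field_simp
    ring

/-- The vertical colour must turn from `b` into `N` at exactly one row of `us`. Each choice of row
is normalised by `Exchange.move`, and the total becomes symmetric in the variables of `us`. The list
`ws` holds the rows already passed. -/
theorem Exchange.step_of_lt {q : K} {f : List (C × K) → K} (hf : Exchange q f) {N b : C}
    (hb : b < N) (y : K) (T : List K) (as : List (C × K)) (has : ∀ a ∈ as, a.1 < N) (G : K → K)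
    (hG : ∀ ls v, (v :: ls).Perm T → f (ls.map (N, ·) ++ (b, v) :: as) = G v)
    (us ws : List K) (hT : (us ++ ws).Perm T) (hu : us.Nodup) :
    NestedLattice.step q N y b (fun l => f (ws.map (N, ·) ++ l)) (us.map (N, ·) ++ as) =
      (as.map fun a => a.2 - y).prod * ∑ v ∈ us.toFinset, (1 - q) * v *
        (∏ l ∈ us.toFinset.erase v, (l - q * y) * ((q * l - v) / (l - v))) * G v := by
  induction us generalizing ws with
  | nil => simp [NestedLattice.step_of_lt q y b _ as has, hb.ne]
  | cons u us ih =>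
    have hu_us : u ∉ us := by intro h; simp [h] at hu
    have hus : us.Nodup := by simp at hu; exact hu.2
    have hm : u ∉ us.toFinset := by simpa using hu_us
    have h₁ := ih (ws ++ [u]) (by
      refine List.Perm.trans ?_ hT
      rw [← List.append_assoc]
      exact List.perm_append_singleton u _) hus
    simp only [List.map_append, List.map_cons, List.map_nil, List.append_assoc, List.cons_append,
      List.nil_append] at h₁
    have h₂ := hf.move hb T as G hG us ws u hT hu
    simp only [List.map_cons, List.cons_append, step_cons, passWeight, swapWeight, hb.ne', hb,
      if_true, if_false, h₁, step_self q y _ us as has, h₂]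
    have hp : (us.map fun u => u - q * y).prod = ∏ l ∈ us.toFinset, (l - q * y) :=
      (List.prod_toFinset _ hus).symm
    rw [hp, List.toFinset_cons, Finset.sum_insert hm, Finset.erase_insert hm,
      Finset.prod_mul_distrib]
    -- Passing row `u` and swapping at row `u` combine through `q (u - y)(u - v) - (1 - q) u (v - q
    -- y) = (u - q y)(q u - v)`.
    have hs : ∀ v ∈ us.toFinset, (1 - q) * v * (∏ l ∈ (insert u us.toFinset).erase v,
          (l - q * y) * ((q * l - v) / (l - v))) * G v =
        q * (u - y) * ((1 - q) * v * (∏ l ∈ us.toFinset.erase v,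
          (l - q * y) * ((q * l - v) / (l - v))) * G v) +
        (1 - q) * u * (∏ l ∈ us.toFinset, (l - q * y)) * (-((1 - q) * v / (u - v)) *
          (∏ l ∈ us.toFinset.erase v, (q * l - v) / (l - v)) * G v) := by
      intro v hv
      have hv' : v ∈ us := by simpa using hv
      have h2 : u ≠ v := fun h => hu_us (h ▸ hv')
      have h2' := sub_ne_zero.2 h2
      rw [Finset.erase_insert_of_ne h2, Finset.prod_insert (by simp [hu_us]),
        ← Finset.mul_prod_erase _ _ hv, Finset.prod_mul_distrib]
      field_simp
      ring
    rw [Finset.sum_congr rfl hs, Finset.sum_add_distrib, ← Finset.mul_sum, ← Finset.mul_sum]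
    ring

end Columns

/-! ### Sums over permutations and reordering of variables. -/

section Permutations

variable {α M : Type*} [AddCommMonoid M]

/-- Permutations are sorted by the image `i` of the last element, matching the removal of the
rightmost marked column. -/
theorem sum_perm_succ {k : ℕ} (F : (Fin (k + 1) → α) → M) (x : Fin (k + 1) → α) :
    ∑ σ : Equiv.Perm (Fin (k + 1)), F (x ∘ σ) =
      ∑ i : Fin (k + 1), ∑ τ : Equiv.Perm (Fin k),
        F (Fin.snoc (α := fun _ => α) ((x ∘ i.succAbove) ∘ τ) (x i)) := by
  rw [← Fintype.sum_prod_type']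
  let e : Fin (k + 1) × Equiv.Perm (Fin k) → Equiv.Perm (Fin (k + 1)) := fun p =>
    ((finSuccEquiv' (Fin.last k)).trans (Equiv.optionCongr p.2)).trans (finSuccEquiv' p.1).symm
  have e_last : ∀ p, e p (Fin.last k) = p.1 := by
    intro p; simp [e]
  have e_cast : ∀ p j, e p (Fin.castSucc j) = p.1.succAbove (p.2 j) := by
    intro p j
    have : finSuccEquiv' (Fin.last k) (Fin.castSucc j) = some j := by
      rw [← Fin.succAbove_last, finSuccEquiv'_succAbove]
    simp only [e, Equiv.trans_apply, this, Equiv.optionCongr_apply, Option.map_some,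
      finSuccEquiv'_symm_some]
  have he : Function.Bijective e := by
    rw [Fintype.bijective_iff_injective_and_card]
    constructor
    · rintro ⟨i, τ⟩ ⟨i', τ'⟩ h
      have h1 : i = i' := (e_last (i, τ)).symm.trans (h ▸ e_last (i', τ'))
      subst h1
      have h2 : τ = τ' := by
        ext j
        have := e_cast (i, τ) j
        rw [h, e_cast] at this
        rw [Fin.succAbove_right_injective this]
      rw [h2]
    · simp [Fintype.card_perm, Nat.factorial_succ]
  refine (Fintype.sum_bijective e he _ _ fun p => ?_).symm
  congr 1
  funext j
  refine Fin.lastCases ?_ (fun j => ?_) j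
  · simp [e_last]
  · simp [e_cast]

theorem exists_perm_of_range_eq {k : ℕ} {x x' : Fin k → α} (hx' : Function.Injective x')
    (h : ∀ i, ∃ j, x j = x' i) : ∃ σ : Equiv.Perm (Fin k), x' = x ∘ σ := by
  choose s hs using h
  have hinj : Function.Injective s := fun i j hij => hx' (by rw [← hs, ← hs, hij])
  exact ⟨Equiv.ofBijective s (Finite.injective_iff_bijective.1 hinj), funext fun i => (hs i).symm⟩

/-- A full sum over permutations is invariant under reordering, because left multiplication by `ρ`
permutes the summands. -/
theorem eq_of_perm_of_eq_sum_perm {k : ℕ} (F : List α → M) (H : (Fin k → α) → M)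
    (h : ∀ x : Fin k → α, Function.Injective x → F (List.ofFn x) = ∑ σ : Equiv.Perm (Fin k), H (x ∘ σ))
    {l l' : List α} (hl : l.Nodup) (hk : l.length = k) (hp : l.Perm l') : F l = F l' := by
  obtain ⟨x, rfl⟩ : ∃ x : Fin k → α, l = List.ofFn x := by
    subst hk; exact ⟨l.get, (List.ofFn_get l).symm⟩
  obtain ⟨x', rfl⟩ : ∃ x' : Fin k → α, l' = List.ofFn x' := by
    have hk' : l'.length = k := by rw [← hp.length_eq, hk]
    subst hk'; exact ⟨l'.get, (List.ofFn_get l').symm⟩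
  have hx' := List.nodup_ofFn.1 (hp.nodup_iff.1 hl)
  obtain ⟨ρ, rfl⟩ := exists_perm_of_range_eq (x := x) hx' fun i => by
    have : x' i ∈ List.ofFn x := hp.mem_iff.2 (by simp)
    simpa [List.mem_ofFn] using this
  rw [h x (List.nodup_ofFn.1 hl), h _ hx']
  exact (Equiv.sum_comp (Equiv.mulLeft ρ) fun σ => H (x ∘ σ)).symm

theorem toFinset_ofFn [DecidableEq α] {k : ℕ} (x : Fin k → α) :
    (List.ofFn x).toFinset = Finset.univ.image x := by
  ext; simp [List.mem_ofFn]

theorem perm_erase_ofFn [DecidableEq α] {k : ℕ} {x : Fin (k + 1) → α} (hx : Function.Injective x)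
    (i : Fin (k + 1)) : ((List.ofFn x).erase (x i)).Perm (List.ofFn (x ∘ i.succAbove)) := by
  have hn := List.nodup_ofFn.2 hx
  rw [List.perm_ext_iff_of_nodup (hn.erase _)
    (List.nodup_ofFn.2 (hx.comp Fin.succAbove_right_injective))]
  intro v
  rw [hn.mem_erase_iff, List.mem_ofFn, List.mem_ofFn]
  constructor
  · rintro ⟨hv, j, rfl⟩
    obtain ⟨l, rfl⟩ := Fin.exists_succAbove_eq fun h : j = i => hv (by rw [h])
    exact ⟨l, rfl⟩
  · rintro ⟨l, rfl⟩
    exact ⟨fun h => Fin.succAbove_ne i l (hx h), i.succAbove l, rfl⟩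

theorem image_erase [DecidableEq α] {k : ℕ} {x : Fin (k + 1) → α} (hx : Function.Injective x)
    (i : Fin (k + 1)) :
    (Finset.univ.image x).erase (x i) = Finset.univ.image (x ∘ i.succAbove) := by
  rw [← toFinset_ofFn, ← toFinset_ofFn, ← List.toFinset_eq_of_perm _ _ (perm_erase_ofFn hx i)]
  ext v
  rw [Finset.mem_erase, List.mem_toFinset, List.mem_toFinset, (List.nodup_ofFn.2 hx).mem_erase_iff]

end Permutations

/-! ### The permutation formula for one layer. -/

section Layer

variable {K : Type*} [Field K]

theorem layerFactor_castSucc {k n : ℕ} (q : K) (x : Fin k → K) (y : Fin (n + 1) → K)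
    (Q : Fin k → Fin n) :
    layerFactor q x y (fun a => ((Q a).castSucc : ℕ) + 1) =
      (∏ a, (x a - q * y (Fin.last n))) *
        layerFactor q x (fun j => y j.castSucc) (fun a => (Q a : ℕ) + 1) := by
  unfold layerFactor
  rw [← mul_assoc, ← Finset.prod_mul_distrib (f := fun a => x a - q * y (Fin.last n))]
  congr 1
  refine Finset.prod_congr rfl fun a _ => ?_
  simp only [Finset.prod_filter, Fin.prod_univ_castSucc, Fin.val_castSucc, Fin.val_last]
  have h₁ : ¬ n + 1 < (Q a : ℕ) + 1 := by omega
  have h₂ : (Q a : ℕ) + 1 < n + 1 := by omega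
  rw [if_neg h₁, if_pos h₂]
  ring

theorem layerFactor_snoc {k n : ℕ} (q : K) (x : Fin k → K) (v : K) (y : Fin (n + 1) → K)
    (Q : Fin (k + 1) → Fin (n + 1)) (Q' : Fin k → Fin n) (hQ : Q (Fin.last k) = Fin.last n)
    (hQ' : ∀ a : Fin k, Q a.castSucc = (Q' a).castSucc) :
    layerFactor q (Fin.snoc (α := fun _ => K) x v) y (fun a => (Q a : ℕ) + 1) =
      (∏ j : Fin n, (v - y j.castSucc)) * ((1 - q) * v) *
        (∏ a, (x a - q * y (Fin.last n)) * ((q * x a - v) / (x a - v))) *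
        layerFactor q x (fun j => y j.castSucc) (fun a => (Q' a : ℕ) + 1) := by
  have h := layerFactor_castSucc q x y Q'
  unfold layerFactor at h ⊢
  rw [Fin.prod_univ_castSucc, Fin.prod_univ_castSucc (n := k)]
  simp only [Fin.snoc_castSucc, Fin.snoc_last, hQ, hQ']
  have h₁ : ∏ i : Fin (n + 1) with i.val + 1 < (Fin.last n).val + 1, (v - y i) =
      ∏ j : Fin n, (v - y j.castSucc) := by
    rw [Finset.prod_filter, Fin.prod_univ_castSucc]
    simp
  have h₂ : ∏ i : Fin (n + 1) with (Fin.last n).val + 1 < i.val + 1, (v - q * y i) = 1 := by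
    rw [Finset.prod_filter]
    refine Finset.prod_eq_one fun i _ => if_neg ?_
    have := i.is_lt
    simp only [Fin.val_last]; omega
  have h₃ : ∏ b : Fin (k + 1) with Fin.last k < b,
      (q * v - Fin.snoc (α := fun _ => K) x v b) / (v - Fin.snoc (α := fun _ => K) x v b) = 1 := by
    rw [Finset.prod_filter]
    exact Finset.prod_eq_one fun i _ => if_neg (Fin.le_last i).not_gt
  have h₄ : ∀ a : Fin k, ∏ b : Fin (k + 1) with a.castSucc < b,
      (q * x a - Fin.snoc (α := fun _ => K) x v b) / (x a - Fin.snoc (α := fun _ => K) x v b) =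
      (∏ b : Fin k with a < b, (q * x a - x b) / (x a - x b)) * ((q * x a - v) / (x a - v)) := by
    intro a
    rw [Finset.prod_filter, Fin.prod_univ_castSucc, Finset.prod_filter]
    simp [Fin.castSucc_lt_last]
  rw [h₁, h₂, h₃, Finset.prod_congr rfl fun a _ => h₄ a,
    Finset.prod_mul_distrib (g := fun a => (q * x a - v) / (x a - v)),
    Finset.prod_mul_distrib (f := fun a => x a - q * y (Fin.last n))]
  beta_reduce at h
  linear_combination (∏ j : Fin n, (v - y j.castSucc)) * ((1 - q) * v) *
    (∏ a, ((q * x a - v) / (x a - v))) * h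

variable {C : Type*} [LinearOrder C]

/-- `Q` lists the columns whose top colour is below `N`. The rows `as` at the bottom are those
already coloured by columns further right; they only pass through the remaining columns, each vertex
contributing `x - y`. They make the induction on columns close. -/
theorem columns_eq_sum {q : K} {f : List (C × K) → K} (hf : Exchange q f) {N : C} {n k : ℕ}
    (x : Fin k → K) (hx : Function.Injective x) (y : Fin n → K) (t : Fin n → C)
    (Q : Fin k → Fin n) (hQ : StrictMono Q) (hQt : ∀ j, t j < N ↔ ∃ a, Q a = j)
    (ht : ∀ j, t j ≤ N) (as : List (C × K)) (has : ∀ a ∈ as, a.1 < N) :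
    columns q N f (List.ofFn fun j => (t j, y j)) ((List.ofFn x).map (N, ·) ++ as) =
      ∑ σ : Equiv.Perm (Fin k), layerFactor q (x ∘ σ) y (fun a => (Q a : ℕ) + 1) *
        ((as.map fun a => ∏ j, (a.2 - y j)).prod *
          f ((List.ofFn fun a => (t (Q a), (x ∘ σ) a)) ++ as)) := by
  classical
  induction n generalizing k as with
  | zero =>
    obtain rfl : k = 0 := by
      rcases k with _ | k
      · rfl
      · exact (Q 0).elim0
    simp [columns, layerFactor]
  | succ n ih =>
    have hcol : columns q N f (List.ofFn fun j => (t j, y j)) =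
        step q N (y (Fin.last n)) (t (Fin.last n))
          (columns q N f (List.ofFn fun j : Fin n => (t j.castSucc, y j.castSucc))) := by
      rw [List.ofFn_succ', List.concat_eq_append, columns_append]
      rfl
    rw [hcol]
    have hg := hf.columns N (List.ofFn fun j : Fin n => (t j.castSucc, y j.castSucc))
    rcases (ht (Fin.last n)).lt_or_eq with hlt | heq
    · obtain ⟨a₀, ha₀⟩ := (hQt _).1 hlt
      rcases k with _ | k
      · exact a₀.elim0
      have hlast : Q (Fin.last k) = Fin.last n :=
        le_antisymm (Fin.le_last _) (ha₀ ▸ hQ.monotone (Fin.le_last a₀))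
      have hex : ∀ a : Fin k, ∃ j : Fin n, j.castSucc = Q a.castSucc := fun a =>
        Fin.exists_castSucc_eq.2 (ne_of_lt (hlast ▸ hQ (Fin.castSucc_lt_last a)))
      choose Q' hQ' using hex
      have hQ'mono : StrictMono Q' := fun a b hab => by
        have := hQ (Fin.castSucc_lt_castSucc_iff.2 hab)
        rwa [← hQ', ← hQ', Fin.castSucc_lt_castSucc_iff] at this
      have hQ't : ∀ j : Fin n, t j.castSucc < N ↔ ∃ a, Q' a = j := by
        intro j
        rw [hQt]
        constructor
        · rintro ⟨a, ha⟩
          induction a using Fin.lastCases with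
          | last => exact absurd (ha.symm.trans hlast) (Fin.castSucc_lt_last j).ne
          | cast a => exact ⟨a, Fin.castSucc_injective _ ((hQ' a).trans ha)⟩
        · rintro ⟨a, rfl⟩
          exact ⟨a.castSucc, (hQ' a).symm⟩
      have ih' := fun (x : Fin k → K) (hx : Function.Injective x) (v : K) =>
        ih x hx (fun j => y j.castSucc) (fun j => t j.castSucc) Q' hQ'mono hQ't
          (fun j => ht _) ((t (Fin.last n), v) :: as)
          (by simpa [hlt] using has)
      -- For equal colours `Exchange` gives symmetry only up to the factor `u - q * v`, which may
      -- vanish. Symmetry is read off the induction hypothesis instead.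
      have hsym : ∀ (v : K) (l l' : List K), l.Nodup → l.length = k → l.Perm l' →
          columns q N f (List.ofFn fun j : Fin n => (t j.castSucc, y j.castSucc))
            (l.map (N, ·) ++ (t (Fin.last n), v) :: as) =
          columns q N f (List.ofFn fun j : Fin n => (t j.castSucc, y j.castSucc))
            (l'.map (N, ·) ++ (t (Fin.last n), v) :: as) := fun v l l' hl hk hp =>
        eq_of_perm_of_eq_sum_perm (fun l =>
          columns q N f (List.ofFn fun j : Fin n => (t j.castSucc, y j.castSucc))
            (l.map (N, ·) ++ (t (Fin.last n), v) :: as)) (fun z =>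
          layerFactor q z (fun j => y j.castSucc) (fun a => (Q' a : ℕ) + 1) *
            ((((t (Fin.last n), v) :: as).map fun a => ∏ j : Fin n, (a.2 - y j.castSucc)).prod *
              f ((List.ofFn fun a => (t (Q' a).castSucc, z a)) ++ (t (Fin.last n), v) :: as)))
          (fun x hx => ih' x hx v) hl hk hp
      have hnodup := List.nodup_ofFn.2 hx
      have hstep := hg.step_of_lt hlt (y (Fin.last n)) (List.ofFn x) as has
        (fun v => columns q N f (List.ofFn fun j : Fin n => (t j.castSucc, y j.castSucc))
          (((List.ofFn x).erase v).map (N, ·) ++ (t (Fin.last n), v) :: as)) (fun l v hp => by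
            have hn := hp.nodup_iff.2 hnodup
            refine hsym v l _ hn.of_cons (by simpa using hp.length_eq) ?_
            simpa using hp.erase v) (List.ofFn x) [] (by simp) hnodup
      simp only [List.map_nil, List.nil_append] at hstep
      rw [hstep, toFinset_ofFn, Finset.sum_image hx.injOn,
        sum_perm_succ (fun z => layerFactor q z y (fun a => (Q a : ℕ) + 1) *
          ((as.map fun a => ∏ j, (a.2 - y j)).prod *
            f ((List.ofFn fun a => (t (Q a), z a)) ++ as))) x, Finset.mul_sum]
      refine Finset.sum_congr rfl fun i _ => ?_
      have hxi : Function.Injective (x ∘ i.succAbove) := hx.comp Fin.succAbove_right_injective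
      rw [hsym (x i) ((List.ofFn x).erase (x i)) (List.ofFn (x ∘ i.succAbove)) (hnodup.erase _)
        (by rw [List.length_erase_of_mem (List.mem_ofFn.2 ⟨i, rfl⟩)]; simp) (perm_erase_ofFn hx i), ih' _ hxi (x i),
        image_erase hx i, Finset.prod_image hxi.injOn, Finset.mul_sum, Finset.mul_sum]
      refine Finset.sum_congr rfl fun τ _ => ?_
      rw [layerFactor_snoc q _ (x i) y Q Q' hlast fun a => (hQ' a).symm, List.ofFn_succ',
        List.concat_eq_append, List.append_assoc]
      simp only [Fin.snoc_last, Fin.snoc_castSucc, hlast, ← hQ', List.map_cons, List.prod_cons,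
        List.cons_append, List.nil_append]
      have hprod : ∏ a, (((x ∘ i.succAbove) ∘ τ) a - q * y (Fin.last n)) *
            ((q * ((x ∘ i.succAbove) ∘ τ) a - x i) / (((x ∘ i.succAbove) ∘ τ) a - x i)) =
          ∏ a, ((x ∘ i.succAbove) a - q * y (Fin.last n)) *
            ((q * (x ∘ i.succAbove) a - x i) / ((x ∘ i.succAbove) a - x i)) :=
        Equiv.prod_comp τ fun a => ((x ∘ i.succAbove) a - q * y (Fin.last n)) *
            ((q * (x ∘ i.succAbove) a - x i) / ((x ∘ i.succAbove) a - x i))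
      have has' : (as.map fun a => ∏ j : Fin (n + 1), (a.2 - y j)).prod =
          (as.map fun a => ∏ j : Fin n, (a.2 - y j.castSucc)).prod *
            (as.map fun a => a.2 - y (Fin.last n)).prod := by
        rw [← List.prod_map_mul]
        simp only [Fin.prod_univ_castSucc]
      rw [hprod, has']
      ring
    · have hex : ∀ a : Fin k, ∃ j : Fin n, j.castSucc = Q a := fun a =>
        Fin.exists_castSucc_eq.2 fun h => ((hQt _).2 ⟨a, h⟩).ne heq
      choose Q' hQ' using hex
      have hQ'mono : StrictMono Q' := fun a b hab => by
        have := hQ hab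
        rwa [← hQ', ← hQ', Fin.castSucc_lt_castSucc_iff] at this
      have hQ't : ∀ j : Fin n, t j.castSucc < N ↔ ∃ a, Q' a = j := by
        intro j
        rw [hQt]
        refine exists_congr fun a => ?_
        rw [← hQ' a, Fin.castSucc_inj]
      rw [heq, step_self _ _ _ _ _ has,
        ih x hx (fun j => y j.castSucc) (fun j => t j.castSucc) Q' hQ'mono hQ't
          (fun j => ht _) as has, Finset.mul_sum, Finset.mul_sum]
      refine Finset.sum_congr rfl fun σ _ => ?_
      have hprod : ((List.ofFn x).map fun u => u - q * y (Fin.last n)).prod =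
          ∏ a, ((x ∘ σ) a - q * y (Fin.last n)) := by
        rw [List.map_ofFn, List.prod_ofFn]
        exact (Equiv.prod_comp σ fun a => x a - q * y (Fin.last n)).symm
      have has' : (as.map fun a => ∏ j : Fin (n + 1), (a.2 - y j)).prod =
          (as.map fun a => ∏ j : Fin n, (a.2 - y j.castSucc)).prod *
            (as.map fun a => a.2 - y (Fin.last n)).prod := by
        rw [← List.prod_map_mul]
        simp only [Fin.prod_univ_castSucc]
      simp only [← hQ', layerFactor_castSucc, hprod, has']
      ring

end Layer

/-! ### Partition functions as iterated column operators and transfer sums. -/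

section PathSum

variable {K : Type*} [CommRing K]

theorem sum_cons {k : ℕ} {X : Fin (k + 1) → Type*} [∀ i, Fintype (X i)]
    {M : Type*} [AddCommMonoid M] (F : (∀ i, X i) → M) :
    ∑ h, F h = ∑ a : X 0, ∑ h : ∀ i : Fin k, X i.succ, F (Fin.cons a h) := by
  rw [← (Fin.consEquiv X).sum_comp, Fintype.sum_prod_type]
  rfl

/-- The sum over all sequences of states from `a` to `b` of the product of the transition
weights. -/
def pathSum {S : Type*} [Fintype S] [DecidableEq S] {n : ℕ} (A : Fin n → S → S → K) (a b : S) : K :=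
  ∑ H : Fin (n + 1) → S,
    if H 0 = a ∧ H (Fin.last n) = b then ∏ j : Fin n, A j (H j.castSucc) (H j.succ) else 0

variable {S : Type*} [Fintype S] [DecidableEq S]

theorem pathSum_zero (A : Fin 0 → S → S → K) (a b : S) :
    pathSum A a b = if a = b then 1 else 0 := by
  unfold pathSum
  rw [sum_cons, Finset.sum_eq_single a]
  · simp
  · intro c _ hc; simp [hc]
  · simp

theorem pathSum_succ {n : ℕ} (A : Fin (n + 1) → S → S → K) (a b : S) :
    pathSum A a b = ∑ c, A 0 a c * pathSum (fun j => A j.succ) c b := by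
  unfold pathSum
  rw [sum_cons, Finset.sum_eq_single a]
  · simp only [Fin.cons_zero, true_and, ← Fin.succ_last, Fin.cons_succ, Fin.prod_univ_succ,
      Fin.castSucc_zero, ← Fin.succ_castSucc, Finset.mul_sum]
    rw [Finset.sum_comm]
    refine Finset.sum_congr rfl fun H _ => ?_
    rw [Finset.sum_eq_single (H 0)]
    · simp
    · intro c _ hc; simp [hc.symm]
    · simp
  · intro c _ hc; simp [hc]
  · simp

end PathSum

section Grid

variable {K : Type*} [CommRing K] {N : ℕ}

/-- Transposing the colourings exposes a path of row-colour vectors from left to right, whose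
transition weights are themselves paths down a column. -/
theorem gridZ_eq_pathSum {k n : ℕ} (q : K) (x : Fin k → K) (y : Fin n → K)
    (left right : Fin k → Fin N) (bottom top : Fin n → Fin N) :
    gridZ q x y left right bottom top =
      pathSum (fun j (a b : Fin k → Fin N) =>
        pathSum (fun i d d' => vertexWeight q (x i) (y j) (a i) d' (b i) d) (top j) (bottom j))
        left right := by
  unfold gridZ
  unfold pathSum
  rw [← (Equiv.piComm fun (_ : Fin (n + 1)) (_ : Fin k) => Fin N).sum_comp]
  refine Finset.sum_congr rfl fun H _ => ?_
  rw [← (Equiv.piComm fun (_ : Fin n) (_ : Fin (k + 1)) => Fin N).sum_comp]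
  simp only [Equiv.piComm_apply, Function.swap]
  by_cases hH : H 0 = left ∧ H (Fin.last n) = right
  · rw [if_pos hH, Finset.prod_univ_sum]
    simp only [Fintype.piFinset_univ, Finset.prod_ite_zero]
    refine Finset.sum_congr rfl fun w _ => ?_
    rw [Finset.prod_comm]
    by_cases hw : ∀ j, w j 0 = top j ∧ w j (Fin.last k) = bottom j
    · rw [if_pos ⟨fun i => congrFun hH.1 i, fun i => congrFun hH.2 i, fun j => (hw j).1,
        fun j => (hw j).2⟩, if_pos fun j _ => hw j]
    · rw [if_neg fun h => hw fun j => ⟨h.2.2.1 j, h.2.2.2 j⟩,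
        if_neg fun h => hw fun j => h j (Finset.mem_univ j)]
  · rw [if_neg hH]
    refine Finset.sum_eq_zero fun w _ => if_neg fun h => hH ⟨funext h.1, funext h.2.1⟩

theorem step_eq_sum {k : ℕ} (q : K) (β : Fin N) (y : K) (t : Fin N)
    (f : List (Fin N × K) → K) (x : Fin k → K) (r : Fin k → Fin N) :
    step q β y t f (List.ofFn fun i => (r i, x i)) =
      ∑ h : Fin k → Fin N, f (List.ofFn fun i => (h i, x i)) *
        pathSum (fun i d d' => vertexWeight q (x i) y (h i) d' (r i) d) t β := by
  induction k generalizing t f with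
  | zero => simp [step_nil, pathSum_zero]
  | succ k ih =>
    rw [sum_cons]
    simp only [List.ofFn_succ, step_cons, ih, Fin.cons_zero, Fin.cons_succ, pathSum_succ,
      vertexWeight_eq]
    have h : ∀ c : Fin N, (∑ h : Fin k → Fin N,
        f ((c, x 0) :: List.ofFn fun i => (h i, x i.succ)) *
          ∑ d : Fin N, ((if c = r 0 ∧ d = t then passWeight q (x 0) y (r 0) t else 0) +
            (if c = t ∧ d = r 0 then swapWeight q (x 0) y (r 0) t else 0)) *
            pathSum (fun i d d' => (if h i = r i.succ ∧ d' = d then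
                passWeight q (x i.succ) y (r i.succ) d else 0) +
              (if h i = d ∧ d' = r i.succ then swapWeight q (x i.succ) y (r i.succ) d else 0)) d β) =
        (if c = r 0 then passWeight q (x 0) y (r 0) t * ∑ h : Fin k → Fin N,
          f ((r 0, x 0) :: List.ofFn fun i => (h i, x i.succ)) *
            pathSum (fun i d d' => (if h i = r i.succ ∧ d' = d then
                passWeight q (x i.succ) y (r i.succ) d else 0) +
              (if h i = d ∧ d' = r i.succ then swapWeight q (x i.succ) y (r i.succ) d else 0)) t β
          else 0) +
        (if c = t then swapWeight q (x 0) y (r 0) t * ∑ h : Fin k → Fin N,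
          f ((t, x 0) :: List.ofFn fun i => (h i, x i.succ)) *
            pathSum (fun i d d' => (if h i = r i.succ ∧ d' = d then
                passWeight q (x i.succ) y (r i.succ) d else 0) +
              (if h i = d ∧ d' = r i.succ then swapWeight q (x i.succ) y (r i.succ) d else 0))
              (r 0) β else 0) := by
      intro c
      simp only [add_mul, Finset.sum_add_distrib, mul_add, ite_and, ite_mul, zero_mul]
      congr 1
      · by_cases hc : c = r 0
        · simp only [hc, if_true, Finset.sum_ite_eq', Finset.mem_univ, Finset.mul_sum]
          exact Finset.sum_congr rfl fun h _ => by ring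
        · simp [hc]
      · by_cases hc : c = t
        · simp only [hc, if_true, Finset.sum_ite_eq', Finset.mem_univ, Finset.mul_sum]
          exact Finset.sum_congr rfl fun h _ => by ring
        · simp [hc]
    simp only [h, Finset.sum_add_distrib, Finset.sum_ite_eq', Finset.mem_univ, if_true]

theorem columns_eq_sum_gridZ {k n : ℕ} (q : K) (β : Fin N) (f : List (Fin N × K) → K)
    (x : Fin k → K) (y : Fin n → K) (right : Fin k → Fin N) (top : Fin n → Fin N) :
    columns q β f (List.ofFn fun j => (top j, y j)) (List.ofFn fun i => (right i, x i)) =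
      ∑ s : Fin k → Fin N, f (List.ofFn fun i => (s i, x i)) *
        gridZ q x y s right (fun _ => β) top := by
  simp only [gridZ_eq_pathSum]
  induction n generalizing f with
  | zero => simp [columns, pathSum_zero]
  | succ n ih =>
    have := ih (step q β (y 0) (top 0) f) (fun j => y j.succ) (fun j => top j.succ)
    rw [List.ofFn_succ, columns, List.foldl_cons]
    refine this.trans ?_
    simp only [step_eq_sum, pathSum_succ _ _ right, Finset.mul_sum, Finset.sum_mul]
    rw [Finset.sum_comm]
    exact Finset.sum_congr rfl fun s _ => Finset.sum_congr rfl fun s' _ => by ring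

end Grid

section DependentPathSum

/-- Used for two kinds of states: colours of the edges joining layers, and permutations of the
auxiliary variables. -/
theorem sum_pi_eq_sum_last {K : Type*} [CommRing K] {m : ℕ} {X : Fin (m + 1) → Type*}
    [∀ p, Fintype (X p)] (A : ∀ p : Fin m, X p.castSucc → X p.succ → K)
    (B : X (Fin.last m) → K) (G : ∀ p, X p → K)
    (hG : ∀ (p : Fin m) (z : X p.succ), G p.succ z = ∑ s, G p.castSucc s * A p s z) :
    ∑ s : ∀ p, X p, G 0 (s 0) * ((∏ p : Fin m, A p (s p.castSucc) (s p.succ)) * B (s (Fin.last m))) =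
      ∑ s, G (Fin.last m) s * B s := by
  induction m with
  | zero =>
    rw [sum_cons]
    simp
  | succ m ih =>
    have ih' := ih (X := fun p => X p.succ) (fun p => A p.succ) B (fun p => G p.succ) fun p z =>
      hG p.succ z
    refine Eq.trans ?_ ih'
    rw [sum_cons, Finset.sum_comm]
    refine Finset.sum_congr rfl fun s _ => ?_
    rw [hG 0 (s 0), Finset.sum_mul]
    refine Finset.sum_congr rfl fun a _ => ?_
    rw [Fin.prod_univ_succ]
    simp only [mul_assoc]
    rfl

end DependentPathSum

/-! ### Coordinates, relabelling and column positions within a layer. -/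

section Positions

theorem nth_mem_eq {k : ℕ} {S : Finset ℕ} {P : Fin k → ℕ} (hP : StrictMono P)
    (hS : ∀ l, l ∈ S ↔ ∃ a, P a = l) (a : Fin k) : Nat.nth (· ∈ S) a = P a := by
  have hcount : Nat.count (· ∈ S) (P a) = a := by
    rw [Nat.count_eq_card_filter_range]
    have : (Finset.range (P a)).filter (· ∈ S) = (Finset.Iio a).image P := by
      ext l
      simp only [Finset.mem_filter, Finset.mem_range, hS, Finset.mem_image, Finset.mem_Iio]
      constructor
      · rintro ⟨hl, b, rfl⟩; exact ⟨b, hP.lt_iff_lt.1 hl, rfl⟩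
      · rintro ⟨b, hb, rfl⟩; exact ⟨hP hb, b, rfl⟩
    rw [this, Finset.card_image_of_injective _ hP.injective, Fin.card_Iio]
  have := Nat.nth_count (p := (· ∈ S)) ((hS (P a)).2 ⟨a, rfl⟩)
  rwa [hcount] at this

theorem exists_strictMono_comp_eq {n k : ℕ} {E : Fin n → ℕ} (hE : StrictMono E) {S : Finset ℕ}
    (hk : S.card = k) (hS : ∀ l ∈ S, ∃ i, E i = l) :
    ∃ Q : Fin k → Fin n, StrictMono Q ∧ (∀ a, E (Q a) = S.orderEmbOfFin hk a) ∧
      ∀ j, E j ∈ S ↔ ∃ a, Q a = j := by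
  have hex : ∀ a, ∃ i, E i = S.orderEmbOfFin hk a := fun a =>
    hS _ (Finset.orderEmbOfFin_mem S hk a)
  choose Q hQ using hex
  refine ⟨Q, fun a b hab => ?_, hQ, fun j => ?_⟩
  · rw [← hE.lt_iff_lt, hQ, hQ]
    exact (S.orderEmbOfFin hk).strictMono hab
  · rw [← Finset.mem_coe, ← Finset.range_orderEmbOfFin S hk]
    refine exists_congr fun a => ?_
    rw [← hQ, hE.injective.eq_iff]

theorem nth_mem_setOf_orderEmbOfFin {k : ℕ} (S : Finset ℕ) (hk : S.card = k) (a : Fin k) :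
    Nat.nth (· ∈ S) a = S.orderEmbOfFin hk a :=
  nth_mem_eq (S.orderEmbOfFin hk).strictMono
    (fun l => by rw [← Finset.mem_coe, ← Finset.range_orderEmbOfFin S hk]; rfl) a

theorem nth_mem_image_card {n k : ℕ} {E : Fin n → ℕ} (hE : StrictMono E) {S B : Finset ℕ}
    (hB : ∀ l, l ∈ B ↔ ∃ i, E i = l) (Q : Fin k → Fin n) (hQ : StrictMono Q) (hS : S ⊆ B)
    (hQS : ∀ j, E j ∈ S ↔ ∃ a, Q a = j) (a : Fin k) :
    Nat.nth (· ∈ S.image fun j => (B.filter (· ≤ j)).card) a = Q a + 1 := by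
  have hcard : ∀ i, (B.filter (· ≤ E i)).card = i + 1 := by
    intro i
    have : B.filter (· ≤ E i) = (Finset.Iic i).image E := by
      ext l
      simp only [Finset.mem_filter, hB, Finset.mem_image, Finset.mem_Iic]
      constructor
      · rintro ⟨⟨b, rfl⟩, hl⟩; exact ⟨b, hE.le_iff_le.1 hl, rfl⟩
      · rintro ⟨b, hb, rfl⟩; exact ⟨⟨b, rfl⟩, hE.monotone hb⟩
    rw [this, Finset.card_image_of_injective _ hE.injective, Fin.card_Iic]
  refine nth_mem_eq (P := fun a => (Q a : ℕ) + 1) (fun a b hab => ?_) (fun l => ?_) a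
  · exact Nat.succ_lt_succ (hQ hab)
  · rw [Finset.mem_image]
    constructor
    · rintro ⟨j, hj, rfl⟩
      obtain ⟨i, rfl⟩ := (hB j).1 (hS hj)
      obtain ⟨b, rfl⟩ := (hQS i).1 hj
      exact ⟨b, (hcard _).symm⟩
    · rintro ⟨b, rfl⟩
      exact ⟨E (Q b), (hQS _).2 ⟨b, rfl⟩, hcard _⟩

end Positions

section Join

variable {α β : Type*} {a b c : ℕ}

theorem join_prodMk (l : Fin a → α) (x : Fin b → α) (r : Fin c → α) (l' : Fin a → β)
    (x' : Fin b → β) (r' : Fin c → β) :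
    (fun j => (join l x r j, join l' x' r' j)) =
      join (fun i => (l i, l' i)) (fun i => (x i, x' i)) (fun i => (r i, r' i)) := by
  funext j
  unfold join
  refine Fin.addCases (fun j => ?_) (fun j => ?_) j
  · refine Fin.addCases (fun j => ?_) (fun j => ?_) j <;> simp
  · simp

theorem ofFn_join (l : Fin a → α) (x : Fin b → α) (r : Fin c → α) :
    List.ofFn (join l x r) = List.ofFn l ++ List.ofFn x ++ List.ofFn r := by
  unfold join
  rw [List.ofFn_fin_append, List.ofFn_fin_append]

theorem comp_join (f : α → β) (l : Fin a → α) (x : Fin b → α) (r : Fin c → α) :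
    (fun j => f (join l x r j)) = join (fun i => f (l i)) (fun i => f (x i)) (fun i => f (r i)) := by
  funext j
  unfold join
  refine Fin.addCases (fun j => ?_) (fun j => ?_) j
  · refine Fin.addCases (fun j => ?_) (fun j => ?_) j <;> simp
  · simp

theorem exists_join_eq (l : Fin a → α) (x : Fin b → α) (r : Fin c → α) (z : α) :
    (∃ j, join l x r j = z) ↔ (∃ i, l i = z) ∨ (∃ i, x i = z) ∨ ∃ i, r i = z := by
  have h : ∀ z, (∃ j, join l x r j = z) ↔ z ∈ List.ofFn (join l x r) := fun z => by
    rw [List.mem_ofFn]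
  rw [h, ofFn_join, List.mem_append, List.mem_append, List.mem_ofFn, List.mem_ofFn, List.mem_ofFn,
    or_assoc]

theorem strictMono_join {l : Fin a → ℕ} {x : Fin b → ℕ} {r : Fin c → ℕ} (hl : StrictMono l)
    (hx : StrictMono x) (hr : StrictMono r) (hlx : ∀ i j, l i < x j) (hlr : ∀ i j, l i < r j)
    (hxr : ∀ i j, x i < r j) : StrictMono (join l x r) := by
  rw [← List.sortedLT_ofFn_iff, ofFn_join, List.sortedLT_iff_pairwise, List.pairwise_append,
    List.pairwise_append, ← List.sortedLT_iff_pairwise, ← List.sortedLT_iff_pairwise,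
    ← List.sortedLT_iff_pairwise, List.sortedLT_ofFn_iff, List.sortedLT_ofFn_iff,
    List.sortedLT_ofFn_iff]
  simp only [List.mem_append, List.mem_ofFn]
  refine ⟨⟨hl, hx, ?_⟩, hr, ?_⟩
  · rintro _ ⟨i, rfl⟩ _ ⟨j, rfl⟩; exact hlx i j
  · rintro _ (⟨i, rfl⟩ | ⟨i, rfl⟩) _ ⟨j, rfl⟩
    · exact hlr i j
    · exact hxr i j

end Join

section Coordinates

variable {m : ℕ} (D : Shape m) (c : ℕ → Fin (m + 2))

/-- The coordinates of the lines crossing layer `p`, from left to right, when the lines which turn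
into the next layer carry the coordinates `setI c p.succ`. -/
def layerCoord (hc : D.Admissible c) (p : Fin m) : Fin (D.LI p + D.k p.succ + D.LII p) → ℕ :=
  join (D.coordI p) ((D.setI c p.succ).orderEmbOfFin (hc.card_eq p.succ)) (D.coordII p)

theorem sum_LI_le (p : Fin m) : (∑ r : Fin m with r.castSucc < p.succ, D.LI r) ≤ ∑ r, D.LI r :=
  Finset.sum_le_sum_of_subset (Finset.filter_subset _ _)

theorem sum_LI_succ (p : Fin m) : (∑ r : Fin m with r.castSucc < p.succ, D.LI r) =
    (∑ r : Fin m with r < p, D.LI r) + D.LI p := by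
  have : (Finset.univ.filter fun r : Fin m => r.castSucc < p.succ) =
      insert p (Finset.univ.filter fun r : Fin m => r < p) := by
    ext r
    simp [Fin.castSucc_lt_succ_iff, le_iff_eq_or_lt]
  rw [this, Finset.sum_insert (by simp), add_comm]

theorem sum_LII_castSucc (p : Fin m) : (∑ r : Fin m with p.castSucc ≤ r.castSucc, D.LII r) =
    (∑ r : Fin m with p < r, D.LII r) + D.LII p := by
  have : (Finset.univ.filter fun r : Fin m => p.castSucc ≤ r.castSucc) =
      insert p (Finset.univ.filter fun r : Fin m => p < r) := by
    ext r
    simp [le_iff_eq_or_lt, eq_comm]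
  rw [this, Finset.sum_insert (by simp), add_comm]

theorem mem_hatI_castSucc (p : Fin m) (l : ℕ) :
    l ∈ D.hatI p.castSucc ↔ (∃ i, D.coordI p i = l) ∨ l ∈ D.hatI p.succ ∨
      ∃ i, D.coordII p i = l := by
  have h₁ := sum_LI_le D p
  have h₂ := sum_LI_succ D p
  have h₃ := sum_LII_castSucc D p
  simp only [Shape.hatI, Shape.coordI, Shape.coordII, Finset.mem_Icc, h₃,
    Fin.succ_le_castSucc_iff, Fin.castSucc_lt_castSucc_iff]
  rw [h₂] at h₁ ⊢
  generalize (∑ r : Fin m with r < p, D.LI r) = a at *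
  generalize (∑ r : Fin m, D.LI r) = b at *
  generalize (∑ r : Fin m with p < r, D.LII r) = d at *
  constructor
  · intro h
    by_cases h₄ : l < a + D.LI p + 1
    · exact Or.inl ⟨⟨l - a - 1, by omega⟩, by simp only; omega⟩
    · by_cases h₅ : l ≤ b + D.LM + d
      · exact Or.inr (Or.inl (by omega))
      · exact Or.inr (Or.inr ⟨⟨l - (b + D.LM + d) - 1, by omega⟩, by simp only; omega⟩)
  · rintro (⟨i, rfl⟩ | h | ⟨i, rfl⟩) <;> omega

theorem coordI_lt_of_mem_hatI (p : Fin m) (i : Fin (D.LI p)) {l : ℕ} (hl : l ∈ D.hatI p.succ) :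
    D.coordI p i < l := by
  have h₂ := sum_LI_succ D p
  simp only [Shape.hatI, Finset.mem_Icc, h₂] at hl
  have := i.is_lt
  unfold Shape.coordI
  omega

theorem lt_coordII_of_mem_hatI (p : Fin m) (i : Fin (D.LII p)) {l : ℕ} (hl : l ∈ D.hatI p.succ) :
    l < D.coordII p i := by
  simp only [Shape.hatI, Finset.mem_Icc, Fin.succ_le_castSucc_iff] at hl
  unfold Shape.coordII
  omega

theorem coordI_lt_coordII (p : Fin m) (i : Fin (D.LI p)) (j : Fin (D.LII p)) :
    D.coordI p i < D.coordII p j := by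
  have h₁ := sum_LI_le D p
  have h₂ := sum_LI_succ D p
  have := i.is_lt
  unfold Shape.coordI Shape.coordII
  omega

variable {D c} (hc : D.Admissible c)

theorem strictMono_layerCoord (p : Fin m) : StrictMono (layerCoord D c hc p) := by
  have hmem : ∀ j, (D.setI c p.succ).orderEmbOfFin (hc.card_eq p.succ) j ∈ D.hatI p.succ :=
    fun j => (Finset.mem_filter.1 (Finset.orderEmbOfFin_mem _ (hc.card_eq p.succ) j)).1
  refine strictMono_join (fun i j h => ?_) (OrderEmbedding.strictMono _) (fun i j h => ?_)
    (fun i j => coordI_lt_of_mem_hatI D p i (hmem j)) (coordI_lt_coordII D p)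
    (fun i j => lt_coordII_of_mem_hatI D p j (hmem i))
  · have : (i : ℕ) < j := h
    unfold Shape.coordI; omega
  · have : (i : ℕ) < j := h
    unfold Shape.coordII; omega

/-- This is why `tildeI` records column numbers: deleting the colours too large for layer `p`
removes nothing from its own quantum spaces and leaves exactly `setI c p.succ` from the layers
above. -/
theorem mem_filter_hatI_iff (p : Fin m) (l : ℕ) :
    l ∈ (D.hatI p.castSucc).filter (fun l => c l ≤ p.castSucc.succ) ↔
      ∃ i, layerCoord D c hc p i = l := by
  have h : (∃ i, (D.setI c p.succ).orderEmbOfFin (hc.card_eq p.succ) i = l) ↔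
      l ∈ D.hatI p.succ ∧ c l ≤ p.castSucc.succ := by
    have hl : l ∈ D.hatI p.succ ∧ c l ≤ p.castSucc.succ ↔ l ∈ D.setI c p.succ := by
      rw [Shape.setI, Finset.mem_filter, Fin.succ_castSucc]
    rw [hl, ← Finset.mem_coe, ← Finset.range_orderEmbOfFin _ (hc.card_eq p.succ)]
    rfl
  rw [layerCoord, exists_join_eq, h, Finset.mem_filter, mem_hatI_castSucc]
  constructor
  · rintro ⟨h₁ | h₁ | h₁, h₂⟩
    · exact Or.inl h₁
    · exact Or.inr (Or.inl ⟨h₁, h₂⟩)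
    · exact Or.inr (Or.inr h₁)
  · rintro (⟨i, rfl⟩ | h₁ | ⟨i, rfl⟩)
    · exact ⟨Or.inl ⟨i, rfl⟩, hc.left_le p i⟩
    · exact ⟨Or.inr (Or.inl h₁.1), h₁.2⟩
    · exact ⟨Or.inr (Or.inr ⟨i, rfl⟩), hc.right_le p i⟩

theorem setI_subset_filter (p : Fin m) :
    D.setI c p.castSucc ⊆ (D.hatI p.castSucc).filter (fun l => c l ≤ p.castSucc.succ) := by
  intro l hl
  rw [Shape.setI, Finset.mem_filter] at hl
  exact Finset.mem_filter.2 ⟨hl.1, hl.2.trans (Fin.castSucc_lt_succ).le⟩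

/-- The positions, in layer `p`, of the lines with coordinates in `setI c p`. -/
theorem exists_layer_positions (p : Fin m) :
    ∃ Q : Fin (D.k p.castSucc) → Fin (D.LI p + D.k p.succ + D.LII p), StrictMono Q ∧
      (∀ a, layerCoord D c hc p (Q a) =
        (D.setI c p.castSucc).orderEmbOfFin (hc.card_eq p.castSucc) a) ∧
      (∀ j, c (layerCoord D c hc p j) < p.castSucc.succ ↔ ∃ a, Q a = j) ∧
      (∀ j, c (layerCoord D c hc p j) ≤ p.castSucc.succ) ∧
      ∀ a : Fin (D.k p.castSucc), Nat.nth (· ∈ D.tildeI c p.castSucc) a = Q a + 1 := by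
  have hB := mem_filter_hatI_iff hc p
  obtain ⟨Q, hQ, hQE, hQS⟩ := exists_strictMono_comp_eq (strictMono_layerCoord hc p)
    (hc.card_eq p.castSucc) fun l hl => (hB l).1 (setI_subset_filter p hl)
  refine ⟨Q, hQ, hQE, fun j => ?_, fun j => ?_, fun a => ?_⟩
  · rw [← hQS, Shape.setI, Finset.mem_filter]
    have hj := Finset.mem_filter.1 ((hB _).2 ⟨j, rfl⟩)
    rw [Fin.lt_def, Fin.le_def]
    simp only [hj.1, true_and, Fin.val_succ, Fin.val_castSucc]
    omega
  · exact (Finset.mem_filter.1 ((hB _).2 ⟨j, rfl⟩)).2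
  · rw [← nth_mem_image_card (strictMono_layerCoord hc p) hB Q hQ (setI_subset_filter p) hQS a]
    simp only [Shape.tildeI, Finset.filter_filter]

/-- The positions, in the top layer, of the lines with coordinates in `setI c (Fin.last m)`. -/
theorem exists_top_positions :
    ∃ Q : Fin (D.k (Fin.last m)) → Fin D.LM, StrictMono Q ∧
      (∀ a, D.coordTop (Q a) =
        (D.setI c (Fin.last m)).orderEmbOfFin (hc.card_eq (Fin.last m)) a) ∧
      (∀ j, c (D.coordTop j) < Fin.last (m + 1) ↔ ∃ a, Q a = j) ∧
      ∀ a : Fin (D.k (Fin.last m)),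
        Nat.nth (· ∈ D.setI c (Fin.last m)) a - ∑ r : Fin m, D.LI r = Q a + 1 := by
  have hE : StrictMono D.coordTop := fun i j h => by
    have : (i : ℕ) < j := h
    unfold Shape.coordTop; omega
  have hhat : ∀ l, l ∈ D.hatI (Fin.last m) ↔ ∃ i, D.coordTop i = l := by
    intro l
    have h : ∀ r : Fin m, ¬ Fin.last m ≤ r.castSucc := fun r => (Fin.castSucc_lt_last r).not_ge
    simp only [Shape.hatI, Fin.castSucc_lt_last, h, Finset.filter_true, Finset.filter_false,
      Finset.sum_empty, Finset.mem_Icc, Shape.coordTop]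
    constructor
    · intro h
      exact ⟨⟨l - (∑ r, D.LI r) - 1, by omega⟩, by simp only; omega⟩
    · rintro ⟨i, rfl⟩; omega
  obtain ⟨Q, hQ, hQE, hQS⟩ := exists_strictMono_comp_eq hE (hc.card_eq (Fin.last m)) fun l hl =>
    (hhat l).1 (Finset.mem_filter.1 hl).1
  refine ⟨Q, hQ, hQE, fun j => ?_, fun a => ?_⟩
  · rw [← hQS, Shape.setI, Finset.mem_filter, Fin.lt_def, Fin.le_def]
    simp only [(hhat _).2 ⟨j, rfl⟩, true_and, Fin.val_last, Fin.val_castSucc]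
    omega
  -- The natural-number subtraction is exact: `coordTop` has the subtracted sum as a summand.
  · rw [nth_mem_setOf_orderEmbOfFin _ (hc.card_eq (Fin.last m)), ← hQE, Shape.coordTop]
    omega

end Coordinates

/-! ### Gluing the layers. -/

section Nested

variable {m : ℕ} {K : Type*}

/-- The partition function of the layers below layer `p`, as a function of the colours and the
variables of the lines which enter layer `p` from the left. -/
def lowerZ [CommRing K] (q : K) (D : Shape m) (X : Spectral D K) (c : ℕ → Fin (m + 2)) :
    Fin (m + 1) → List (Fin (m + 2) × K) → K :=
  Fin.induction (fun l => if ∀ a ∈ l, a.1 = 0 then 1 else 0) fun p f l =>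
    columns q p.castSucc.succ f
      ((List.ofFn fun i => (c (D.coordI p i), X.vI p i)) ++ l ++
        List.ofFn fun i => (c (D.coordII p i), X.vII p i))
      ((List.ofFn (X.u p.castSucc)).map (p.castSucc.succ, ·))

section Ring

variable [CommRing K] (q : K) (D : Shape m) (X : Spectral D K) (c : ℕ → Fin (m + 2))

theorem lowerZ_zero (l : List (Fin (m + 2) × K)) :
    lowerZ q D X c 0 l = if ∀ a ∈ l, a.1 = 0 then 1 else 0 := rfl

theorem lowerZ_succ (p : Fin m) (s : Fin (D.k p.succ) → Fin (m + 2)) (x : Fin (D.k p.succ) → K) :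
    lowerZ q D X c p.succ (List.ofFn fun i => (s i, x i)) =
      columns q p.castSucc.succ (lowerZ q D X c p.castSucc)
        (List.ofFn fun j => (join (fun i => c (D.coordI p i)) s (fun i => c (D.coordII p i)) j,
          join (X.vI p) x (X.vII p) j))
        ((List.ofFn (X.u p.castSucc)).map (p.castSucc.succ, ·)) := by
  rw [join_prodMk, ofFn_join]
  rfl

theorem exchange_lowerZ (p : Fin (m + 1)) : Exchange q (lowerZ q D X c p) := by
  refine Fin.cases ?_ (fun p => ?_) p
  · intro pre l a b u v
    simp only [lowerZ_zero, List.forall_mem_append, List.forall_mem_cons, passWeight, swapWeight]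
    by_cases ha : a = 0 <;> by_cases hb : b = 0
    · subst ha hb
      simp
    · simp [ha, hb]
    · simp [ha, hb]
    · simp [ha, hb]
  · exact exchange_columns q _ _ _ _ _

/-- The sum over connecting colours is absorbed into `lowerZ` layer by layer; at the bottom its
initial value selects the constant left colour `0`. -/
theorem psi_eq_columns :
    psi q D X c = columns q (Fin.last (m + 1)) (lowerZ q D X c (Fin.last m))
      (List.ofFn fun i => (c (D.coordTop i), X.vM i))
      ((List.ofFn (X.u (Fin.last m))).map (Fin.last (m + 1), ·)) := by
  have hmap : ∀ (k : ℕ) (x : Fin k → K) (β : Fin (m + 2)),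
      (List.ofFn x).map (β, ·) = List.ofFn fun i => ((fun _ => β : Fin k → Fin (m + 2)) i, x i) :=
    fun k x β => by rw [List.map_ofFn]; rfl
  rw [hmap, columns_eq_sum_gridZ,
    ← sum_pi_eq_sum_last (X := fun p => Fin (D.k p) → Fin (m + 2))
      (fun p s s' => gridZ q (X.u p.castSucc) (join (X.vI p) (X.u p.succ) (X.vII p)) s
        (fun _ => p.castSucc.succ) (fun _ => p.castSucc.succ)
        (join (fun i => c (D.coordI p i)) s' (fun i => c (D.coordII p i))))
      (fun s => gridZ q (X.u (Fin.last m)) X.vM s (fun _ => Fin.last (m + 1))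
        (fun _ => Fin.last (m + 1)) (fun i => c (D.coordTop i)))
      (fun p s => lowerZ q D X c p (List.ofFn fun i => (s i, X.u p i)))
      (fun p s => by rw [lowerZ_succ, hmap, columns_eq_sum_gridZ]),
    sum_cons, Finset.sum_eq_single fun _ => 0]
  · refine Finset.sum_congr rfl fun s _ => ?_
    rw [lowerZ_zero, if_pos (by simp [List.mem_ofFn]), one_mul]
    rfl
  · intro a _ ha
    refine Finset.sum_eq_zero fun s _ => ?_
    rw [lowerZ_zero, if_neg, zero_mul]
    intro h
    refine ha (funext fun i => h (a i, X.u 0 i) ?_)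
    rw [List.mem_ofFn]
    exact ⟨i, rfl⟩
  · simp

end Ring

end Nested

end NestedLattice

open NestedLattice in
theorem mainTheorem2 {K : Type*} [Field K] (q : K) {m : ℕ} (D : NestedLattice.Shape m)
    (X : NestedLattice.Spectral D K) (c : ℕ → Fin (m + 2)) (hc : D.Admissible c)
    (hu : ∀ p : Fin (m + 1), Function.Injective (X.u p)) :
    NestedLattice.psi q D X c = NestedLattice.weightW q D X c := by
  -- Coordinates in `setI c 0` all have colour `0`, so the recursion starts from `1` for every
  -- permutation.
  have hone : ∀ σ : Equiv.Perm (Fin (D.k 0)), lowerZ q D X c 0 (List.ofFn fun i =>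
      (c ((D.setI c 0).orderEmbOfFin (hc.card_eq 0) i), X.u 0 (σ i))) = 1 := by
    intro σ
    rw [lowerZ_zero, if_pos]
    intro a ha
    obtain ⟨i, rfl⟩ := List.mem_ofFn.1 ha
    have := (Finset.mem_filter.1 (Finset.orderEmbOfFin_mem _ (hc.card_eq 0) i)).2
    exact Fin.le_zero_iff.1 this
  have hsum := sum_pi_eq_sum_last (X := fun p => Equiv.Perm (Fin (D.k p)))
    (fun p σ σ' => layerFactor q (fun a => X.u p.castSucc (σ a))
        (join (X.vI p) (fun i => X.u p.succ (σ' i)) (X.vII p))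
        (fun a => Nat.nth (· ∈ D.tildeI c p.castSucc) a))
    (fun σ => layerFactor q (fun a => X.u (Fin.last m) (σ a)) X.vM
      (fun a => Nat.nth (· ∈ D.setI c (Fin.last m)) a - ∑ r : Fin m, D.LI r))
    (fun p σ => lowerZ q D X c p (List.ofFn fun i =>
      (c ((D.setI c p).orderEmbOfFin (hc.card_eq p) i), X.u p (σ i)))) ?_
  · simp only [hone, one_mul] at hsum
    rw [psi_eq_columns, weightW, hsum]
    obtain ⟨Q, hQ, hQE, hQc, hnth⟩ := exists_top_positions hc
    have h := columns_eq_sum (exchange_lowerZ q D X c (Fin.last m)) (X.u (Fin.last m)) (hu _) X.vM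
      (fun i => c (D.coordTop i)) Q hQ hQc (fun j => Fin.le_last _) [] (by simp)
    simp only [List.append_nil, List.map_nil, List.prod_nil, one_mul, hQE] at h
    simp only [h, hnth]
    exact Finset.sum_congr rfl fun σ _ => mul_comm _ _
  -- The recursion: layer `p` is evaluated with its turning lines carrying the variables permuted by
  -- `σ'` and the colours of `setI c p.succ`.
  · intro p σ'
    obtain ⟨Q, hQ, hQE, hQc, hle, hnth⟩ := exists_layer_positions hc p
    have h := columns_eq_sum (exchange_lowerZ q D X c p.castSucc) (X.u p.castSucc) (hu _)
      (join (X.vI p) (fun i => X.u p.succ (σ' i)) (X.vII p))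
      (fun i => c (layerCoord D c hc p i)) Q hQ hQc hle [] (by simp)
    simp only [List.append_nil, List.map_nil, List.prod_nil, one_mul, hQE] at h
    rw [lowerZ_succ]
    have hcomp : ∀ j, join (fun i => c (D.coordI p i))
        (fun i => c ((D.setI c p.succ).orderEmbOfFin (hc.card_eq p.succ) i))
        (fun i => c (D.coordII p i)) j = c (layerCoord D c hc p j) := fun j =>
      (congrFun (comp_join c _ _ _) j).symm
    simp only [hcomp, hnth, h]
    exact Finset.sum_congr rfl fun σ _ => mul_comm _ _
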